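/- An instance $I$ of coloured bin packing consists of $n$ items, each item $e$ with a size $s(e)\in(0,1]$ and one of $m$ colours; $I_c$ is the set of items of colour $c$. A packing assigns every item to exactly one bin so that each bin has total size at most $1$; $\mathrm{OPT}(X)$ is the smallest number of bins in a packing of the set of items $X$. For a packing $P$ of $I$, let $P(I)$ be its number of bins and $P_c(I)$ the number of bins containing an item of colour $c$. For $\varepsilon>0$ consider the following algorithm $A_\varepsilon$. (1) Order the colours arbitrarily, and for each colour $c$ pack $I_c$ separately by the APTAS of Fernandez de la Vega and Lueker with parameter $\varepsilon$: sort the $N$ large items (size $\ge\varepsilon$) of $I_c$ by increasing size, cut this list into $\lceil 1/\varepsilon^2\rceil$ consecutive groups of at most $\lceil N\varepsilon^2\rceil$ items, round each large item up to the largest size in its group, take an optimal packing of the rounded items (found by enumerating the multisets of at most $N$ bin types), and then add the small items (size $<\varepsilon$), in any order and with the original sizes, by First Fit. (2) Pack all items anew, in the order in which they appear in the packings of step (1), by Bounded Best-Fit with $k=2$: at most $k$ bins are open; an item is put into a fullest open bin with room for it; if there is none, a new bin is opened for the item, after closing (for ever) a fullest open bin if already $k$ bins are open. Ties are broken arbitrarily.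 Theorem. (a) There is an absolute constant $C$ such that for every $\varepsilon>0$, every instance $I$, and all arbitrary choices made by $A_\varepsilon$, the output $P'$ of $A_\varepsilon$ is a packing of $I$ with $$P'_c(I)\le(1+2\varepsilon)\,\mathrm{OPT}(I_c)+3\ \text{ for every colour } c,\qquad P'(I)\le 1.7\,\mathrm{OPT}(I)+C .$$ (b) Consequently, for every $\varepsilon>0$, $A_{\varepsilon/2}$ is a $(1.7,1+\varepsilon)$-approximation algorithm: there is a constant $C'$ independent of the instance such that, on every instance $I$, it has an output, and every output is a packing $P'$ of $I$ with $P'(I)\le1.7\,\mathrm{OPT}(I)+C'$ and $P'_c(I)\le(1+\varepsilon)\,\mathrm{OPT}(I_c)+C'$ for every colour $c$. (c) For every fixed $\varepsilon>0$, $A_\varepsilon$ runs in polynomial time: an explicit implementation of it, which enumerates bin types and packings by brute force, produces on every instance with $n$ items and $m$ colours a possible output of $A_\varepsilon$ in at most $p(n+m)$ steps, where the polynomial $p$ depends only on $\varepsilon$ (unit-cost arithmetic on real numbers). -/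

import Mathlib

noncomputable section

namespace ColouredBinPacking

/-! ### Instances, packings, optima -/

/-- `n` items with sizes in `(0, 1]`, each with one of `m` colours. -/
structure ColouredInstance (n m : ℕ) where
  size : Fin n → ℝ
  colour : Fin n → Fin m
  size_pos : ∀ e, 0 < size e
  size_le_one : ∀ e, size e ≤ 1

/-- The items of colour `c`. -/
def ColouredInstance.ofColour {n m : ℕ} (I : ColouredInstance n m) (c : Fin m) : Finset (Fin n) :=
  Finset.univ.filter (fun e => I.colour e = c)

/-- `l` lists every element of `X` exactly once (and nothing else). -/
def Enumerates {ι : Type} (l : List ι) (X : Finset ι) : Prop :=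
  l.Nodup ∧ ∀ e, e ∈ l ↔ e ∈ X

/-- Total size of the items in a bin; a bin is the list of its items, in the order of packing. -/
def load {ι : Type} (s : ι → ℝ) (B : List ι) : ℝ := (B.map s).sum

/-- `P` is a packing of the items `X` with sizes `s` into unit-capacity bins. -/
def IsPacking {ι : Type} (s : ι → ℝ) (X : Finset ι) (P : List (List ι)) : Prop :=
  Enumerates P.flatten X ∧ ∀ B ∈ P, load s B ≤ 1

/-- The smallest number of bins that suffice for the items `X` with sizes `s`. -/
def OPT {ι : Type} (s : ι → ℝ) (X : Finset ι) : ℕ :=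
  sInf {k : ℕ | ∃ P : List (List ι), IsPacking s X P ∧ P.length = k}

/-- The number of bins of `P` that contain an item of colour `c`. -/
def span {n m : ℕ} (I : ColouredInstance n m) (P : List (List (Fin n))) (c : Fin m) : ℕ :=
  P.countP (fun B => B.any (fun e => I.colour e = c))

/-- `A n m I P` says that `P` is a possible output of the (nondeterministic) algorithm `A` on `I`.
`A` is an `(α, β)`-approximation algorithm: on every instance it has an output, and every output is
a packing with at most `α OPT(I) + O(1)` bins in which each colour `c` spans at most
`β OPT(I_c) + O(1)` bins, the implied constant being independent of the instance. -/
def IsApproximationAlgorithm (α β : ℝ)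
    (A : (n m : ℕ) → ColouredInstance n m → List (List (Fin n)) → Prop) : Prop :=
  ∃ C : ℝ, ∀ (n m : ℕ) (I : ColouredInstance n m),
    (∃ P, A n m I P) ∧
    ∀ P, A n m I P →
      IsPacking I.size Finset.univ P ∧
      (P.length : ℝ) ≤ α * (OPT I.size Finset.univ : ℝ) + C ∧
      ∀ c : Fin m, (span I P c : ℝ) ≤ β * (OPT I.size (I.ofColour c) : ℝ) + C

/-! ### The APTAS of Fernandez de la Vega and Lueker, with all its arbitrary choices -/

/-- First Fit for one item. -/
def firstFitItem {ι : Type} (s : ι → ℝ) (e : ι) : List (List ι) → List (List ι)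
  | [] => [[e]]
  | B :: P => if load s B + s e ≤ 1 then (B ++ [e]) :: P else B :: firstFitItem s e P

/-- First Fit for the items of `S`, in this order, on top of the packing `P`. -/
def firstFit {ι : Type} (s : ι → ℝ) (P : List (List ι)) (S : List ι) : List (List ι) :=
  S.foldl (fun P e => firstFitItem s e P) P

/-- Cut a list into `K` consecutive groups of at most `q` items each. -/
def groups {ι : Type} (q : ℕ) : ℕ → List ι → List (List ι)
  | 0, _ => []
  | K + 1, L => L.take q :: groups q K (L.drop q)

/-- `P` is a possible output of the APTAS with parameter `ε` on the items `X`: the large items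
(size at least `ε`) are sorted by increasing size into a list `L` and cut into `⌈1/ε²⌉` groups of
at most `⌈|L| ε²⌉` items; `r` rounds each large item up to the largest size in its group; `Q` is a
best packing of the large items with the sizes `r`; finally the small items are added to `Q`
by First Fit (with the true sizes) in some order `S`. -/
def IsVLPacking {ι : Type} (s : ι → ℝ) (ε : ℝ) (X : Finset ι) (P : List (List ι)) : Prop :=
  ∃ (L S : List ι) (r : ι → ℝ) (Q : List (List ι)),
    Enumerates L (X.filter (fun e => ε ≤ s e)) ∧
    L.Pairwise (fun e f => s e ≤ s f) ∧
    Enumerates S (X.filter (fun e => s e < ε)) ∧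
    (∀ g ∈ groups ⌈(L.length : ℝ) * ε ^ 2⌉₊ ⌈1 / ε ^ 2⌉₊ L, ∀ e ∈ g,
      IsGreatest (s '' {x | x ∈ g}) (r e)) ∧
    IsPacking r (X.filter (fun e => ε ≤ s e)) Q ∧
    (∀ Q', IsPacking r (X.filter (fun e => ε ≤ s e)) Q' → Q.length ≤ Q'.length) ∧
    P = firstFit s Q S

/-! ### Bounded Best-Fit -/

/-- Closed bins and open bins. -/
structure BBFState (ι : Type) where
  closed : List (List ι)
  opened : List (List ι)

/-- One step of Bounded Best-Fit with at most `k` open bins, ties being broken arbitrarily. -/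
inductive BBFStep {ι : Type} (s : ι → ℝ) (k : ℕ) : BBFState ι → ι → BBFState ι → Prop
  /-- `B` is a fullest open bin among those with room for `e`. -/
  | fit (cl op : List (List ι)) (e : ι) (B : List ι) (rest : List (List ι)) :
      op.Perm (B :: rest) → load s B + s e ≤ 1 →
      (∀ B' ∈ op, load s B' + s e ≤ 1 → load s B' ≤ load s B) →
      BBFStep s k ⟨cl, op⟩ e ⟨cl, (B ++ [e]) :: rest⟩
  /-- No open bin has room for `e`, and fewer than `k` bins are open. -/
  | new (cl op : List (List ι)) (e : ι) :
      (∀ B' ∈ op, 1 < load s B' + s e) → op.length < k →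
      BBFStep s k ⟨cl, op⟩ e ⟨cl, [e] :: op⟩
  /-- No open bin has room for `e`, and `k` bins are open: a fullest one, `B`, is closed. -/
  | close (cl op : List (List ι)) (e : ι) (B : List ι) (rest : List (List ι)) :
      (∀ B' ∈ op, 1 < load s B' + s e) → op.length = k →
      op.Perm (B :: rest) → (∀ B' ∈ op, load s B' ≤ load s B) →
      BBFStep s k ⟨cl, op⟩ e ⟨B :: cl, [e] :: rest⟩

/-- Bounded Best-Fit on a sequence of items. -/
inductive BBFRun {ι : Type} (s : ι → ℝ) (k : ℕ) : BBFState ι → List ι → BBFState ι → Prop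
  | nil (σ : BBFState ι) : BBFRun s k σ [] σ
  | cons (σ τ υ : BBFState ι) (e : ι) (l : List ι) :
      BBFStep s k σ e τ → BBFRun s k τ l υ → BBFRun s k σ (e :: l) υ

/-! ### The algorithm -/

/-- `P'` is a possible output of the algorithm with parameter `ε` on the instance `I`: for some
order of the colours and some outputs `P c` of the APTAS on the individual colours, `P'` is obtained
by Bounded Best-Fit with two open bins on the items in the order in which they appear in the
packings `P c`. -/
def IsOutput (ε : ℝ) (n m : ℕ) (I : ColouredInstance n m) (P' : List (List (Fin n))) : Prop :=
  ∃ (colours : List (Fin m)) (P : Fin m → List (List (Fin n))) (σ : BBFState (Fin n)),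
    Enumerates colours Finset.univ ∧
    (∀ c, IsVLPacking I.size ε (I.ofColour c) (P c)) ∧
    BBFRun I.size 2 ⟨[], []⟩ (colours.flatMap P).flatten σ ∧
    P' = σ.closed ++ σ.opened

/-! ### An implementation with a step count

Unit-cost model. Every procedure below charges one step per call (including each recursive call);
apart from calls of other such procedures, the body of a call performs only a bounded number of
elementary operations: building or matching list cells and pairs, looking up the size or colour
of an item, and arithmetic operations, comparisons and roundings of numbers. -/

/-- A value together with the number of steps spent on computing it. -/
structure Timed (α : Type) where
  val : α
  steps : ℕ

instance : Monad Timed where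
  pure a := ⟨a, 0⟩
  bind x f := ⟨(f x.val).val, x.steps + (f x.val).steps⟩

/-- Charge one step. -/
def tick : Timed Unit := ⟨(), 1⟩

def lengthT {α : Type} : List α → Timed ℕ
  | [] => do tick; pure 0
  | _ :: l => do tick; let r ← lengthT l; pure (r + 1)

def appendT {α : Type} : List α → List α → Timed (List α)
  | [], l' => do tick; pure l'
  | a :: l, l' => do tick; let r ← appendT l l'; pure (a :: r)

def flattenT {α : Type} : List (List α) → Timed (List α)
  | [] => do tick; pure []
  | l :: ls => do tick; let r ← flattenT ls; appendT l r

def filterT {α : Type} (p : α → Timed Bool) : List α → Timed (List α)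
  | [] => do tick; pure []
  | a :: l => do
    tick
    let b ← p a
    let r ← filterT p l
    pure (if b then a :: r else r)

def mapT {α β : Type} (f : α → Timed β) : List α → Timed (List β)
  | [] => do tick; pure []
  | a :: l => do tick; let b ← f a; let r ← mapT f l; pure (b :: r)

def flatMapT {α β : Type} (f : α → Timed (List β)) : List α → Timed (List β)
  | [] => do tick; pure []
  | a :: l => do tick; let b ← f a; let r ← flatMapT f l; appendT b r

def foldlT {α β : Type} (f : β → α → Timed β) : β → List α → Timed β
  | b, [] => do tick; pure b
  | b, a :: l => do tick; let b' ← f b a; foldlT f b' l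

/-- Split off the first `q` elements. -/
def splitT {α : Type} : ℕ → List α → Timed (List α × List α)
  | 0, l => do tick; pure ([], l)
  | _ + 1, [] => do tick; pure ([], [])
  | q + 1, a :: l => do tick; let r ← splitT q l; pure (a :: r.1, r.2)

/-- The list `[b, b - 1, …, 0]`. -/
def downT : ℕ → Timed (List ℕ)
  | 0 => do tick; pure [0]
  | b + 1 => do tick; let r ← downT b; pure ((b + 1) :: r)

/-- All vectors of `t` natural numbers with sum at most `b`. -/
def vectorsT : ℕ → ℕ → Timed (List (List ℕ))
  | 0, _ => do tick; pure [[]]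
  | t + 1, b => do
    tick
    let as ← downT b
    flatMapT (fun a => do
      let vs ← vectorsT t (b - a)
      mapT (fun v => do tick; pure (a :: v)) vs) as

def sumT : List ℕ → Timed ℕ
  | [] => do tick; pure 0
  | a :: v => do tick; let r ← sumT v; pure (a + r)

def dotT : List ℕ → List ℝ → Timed ℝ
  | a :: v, x :: w => do tick; let r ← dotT v w; pure ((a : ℝ) * x + r)
  | _, _ => do tick; pure 0

/-- `a • v + w`. -/
def addMulT (a : ℕ) : List ℕ → List ℕ → Timed (List ℕ)
  | x :: v, y :: w => do tick; let r ← addMulT a v w; pure ((a * x + y) :: r)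
  | _, _ => do tick; pure []

/-- The combination `∑ aᵢ • τᵢ` of the vectors `τᵢ`, added to `z`. -/
def combineT (z : List ℕ) : List ℕ → List (List ℕ) → Timed (List ℕ)
  | a :: as, τ :: τs => do tick; let r ← combineT z as τs; addMulT a τ r
  | _, _ => do tick; pure z

def eqT : List ℕ → List ℕ → Timed Bool
  | [], [] => do tick; pure true
  | a :: v, b :: w => do tick; let r ← eqT v w; pure (a == b && r)
  | _, _ => do tick; pure false

/-- A vector with the smallest sum. -/
def minSumT : List (List ℕ) → Timed (Option (List ℕ))
  | [] => do tick; pure none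
  | v :: vs => do
    tick
    let r ← minSumT vs
    match r with
    | none => pure (some v)
    | some w => do
      let a ← sumT v
      let b ← sumT w
      pure (some (if a ≤ b then v else w))

def loadT {ι : Type} (s : ι → ℝ) : List ι → Timed ℝ
  | [] => do tick; pure 0
  | e :: B => do tick; let r ← loadT s B; pure (s e + r)

def insertT {ι : Type} (s : ι → ℝ) (e : ι) : List ι → Timed (List ι)
  | [] => do tick; pure [e]
  | f :: l => do
    tick
    if s e ≤ s f then pure (e :: f :: l) else do
      let r ← insertT s e l
      pure (f :: r)

/-- Insertion sort by increasing size. -/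
def sortT {ι : Type} (s : ι → ℝ) : List ι → Timed (List ι)
  | [] => do tick; pure []
  | e :: l => do tick; let r ← sortT s l; insertT s e r

def groupsT {ι : Type} (q : ℕ) : ℕ → List ι → Timed (List (List ι))
  | 0, _ => do tick; pure []
  | K + 1, L => do
    tick
    let r ← splitT q L
    let gs ← groupsT q K r.2
    pure (r.1 :: gs)

/-- The largest size in a group (`0` for an empty group). -/
def maxSizeT {ι : Type} (s : ι → ℝ) : List ι → Timed ℝ
  | [] => do tick; pure 0
  | e :: g => do tick; let r ← maxSizeT s g; pure (max (s e) r)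

/-- Fill one bin with `τ j` items of the `j`-th group, for all `j`; the second component holds the
items that are left over in the groups. -/
def fillBinT {ι : Type} : List ℕ → List (List ι) → Timed (List ι × List (List ι))
  | a :: τ, g :: gs => do
    tick
    let x ← splitT a g
    let r ← fillBinT τ gs
    let B ← appendT x.1 r.1
    pure (B, x.2 :: r.2)
  | _, gs => do tick; pure ([], gs)

/-- Fill `a` bins of the same type `τ`. -/
def fillCopiesT {ι : Type} (τ : List ℕ) :
    ℕ → List (List ι) → Timed (List (List ι) × List (List ι))
  | 0, gs => do tick; pure ([], gs)
  | a + 1, gs => do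
    tick
    let x ← fillBinT τ gs
    let r ← fillCopiesT τ a x.2
    pure (x.1 :: r.1, r.2)

/-- Fill `aᵢ` bins of type `τᵢ` for all `i`. -/
def fillT {ι : Type} : List ℕ → List (List ℕ) → List (List ι) → Timed (List (List ι))
  | a :: as, τ :: τs, gs => do
    tick
    let x ← fillCopiesT τ a gs
    let r ← fillT as τs x.2
    appendT x.1 r
  | _, _, _ => do tick; pure []

/-- The large items, sorted by increasing size, are grouped and rounded up; all bin types (a bin
type says how many items of each group a bin holds, at most `⌊1/ε⌋` in all) and then all packings
with at most as many bins as items (given by the number of bins of each type) are enumerated, and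
the best packing is chosen. -/
def packLargeT {ι : Type} (s : ι → ℝ) (ε : ℝ) (L : List ι) : Timed (List (List ι)) := do
  tick
  let N ← lengthT L
  let gs ← groupsT ⌈(N : ℝ) * ε ^ 2⌉₊ ⌈1 / ε ^ 2⌉₊ L
  let sizes ← mapT (maxSizeT s) gs
  let demand ← mapT lengthT gs
  let zeros ← mapT (fun _ => do tick; pure 0) gs
  let vectors ← vectorsT ⌈1 / ε ^ 2⌉₊ ⌊1 / ε⌋₊
  let types ← filterT (fun τ => do let w ← dotT τ sizes; pure (decide (w ≤ 1))) vectors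
  let t ← lengthT types
  let candidates ← vectorsT t N
  let packings ← filterT (fun v => do let d ← combineT zeros v types; eqT d demand) candidates
  let best ← minSumT packings
  fillT (best.getD []) types gs

def firstFitItemT {ι : Type} (s : ι → ℝ) (e : ι) : List (List ι) → Timed (List (List ι))
  | [] => do tick; pure [[e]]
  | B :: P => do
    tick
    let w ← loadT s B
    if w + s e ≤ 1 then do
      let B' ← appendT B [e]
      pure (B' :: P)
    else do
      let P' ← firstFitItemT s e P
      pure (B :: P')

/-- The APTAS with parameter `ε` on a list of items. -/
def vlT {ι : Type} (s : ι → ℝ) (ε : ℝ) (X : List ι) : Timed (List (List ι)) := do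
  tick
  let large ← filterT (fun e => do tick; pure (decide (ε ≤ s e))) X
  let small ← filterT (fun e => do tick; pure (decide (s e < ε))) X
  let L ← sortT s large
  let Q ← packLargeT s ε L
  foldlT (fun P e => firstFitItemT s e P) Q small

/-- A fullest bin among those with load at most `cap`, together with the other bins. -/
def fullestT {ι : Type} (s : ι → ℝ) (cap : ℝ) :
    List (List ι) → Timed (Option (List ι × List (List ι)))
  | [] => do tick; pure none
  | B :: Bs => do
    tick
    let w ← loadT s B
    let r ← fullestT s cap Bs
    match r with
    | none => pure (if w ≤ cap then some (B, Bs) else none)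
    | some x => do
      let w' ← loadT s x.1
      pure (some (if w ≤ cap ∧ w' ≤ w then (B, Bs) else (x.1, B :: x.2)))

/-- One step of Bounded Best-Fit with at most `k` open bins. -/
def bbfStepT {ι : Type} (s : ι → ℝ) (k : ℕ) (σ : BBFState ι) (e : ι) : Timed (BBFState ι) := do
  tick
  let r ← fullestT s (1 - s e) σ.opened
  match r with
  | some x => do
    let B ← appendT x.1 [e]
    pure ⟨σ.closed, B :: x.2⟩
  | none => do
    let j ← lengthT σ.opened
    if j < k then pure ⟨σ.closed, [e] :: σ.opened⟩ else do
      let r' ← fullestT s 1 σ.opened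
      match r' with
      | some x => pure ⟨x.1 :: σ.closed, [e] :: x.2⟩
      | none => pure ⟨σ.closed, [e] :: σ.opened⟩

/-- The whole algorithm with parameter `ε`; the input consists of the list of items, the list of
colours, and the sizes and colours of the items. -/
def algorithmT (ε : ℝ) {n m : ℕ} (I : ColouredInstance n m) : Timed (List (List (Fin n))) := do
  tick
  let order ← flatMapT (fun c => do
    let X ← filterT (fun e => do tick; pure (decide (I.colour e = c))) (List.finRange n)
    let P ← vlT I.size ε X
    flattenT P) (List.finRange m)
  let σ ← foldlT (bbfStepT I.size 2) ⟨[], []⟩ order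
  appendT σ.closed σ.opened

end ColouredBinPacking

end

/-!
The bound `1.7 * OPT + O(1)` for Bounded Best-Fit with two open bins comes from weights. An item of
size `x` weighs `6 / 5 * x + bonus x`, where the bonus vanishes up to `1 / 6`, rises linearly to
`1 / 10` at `1 / 3`, stays there up to `1 / 2` and is `2 / 5` beyond. The bonuses in one bin add up
to at most `1 / 2` (`load_bonus_le_bonusCap`), so a bin of any packing weighs at most `17 / 10`. It
remains to see that the number of closed bins never exceeds the weight of the items packed so far. A
bin closed at load `a` may weigh less than `1`, the deficit being at most `1 - 6 / 5 * a`. Since the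
placement of an item depends only on the loads of the two open bins, the deficits can be controlled
by a potential of these two loads (`potential`): it bounds from below the bonuses still to come
minus the deficits still to come, and is `0` unless both bins are more than half full. That every step
respects it (`potential_fit`, `potential_new`, `potential_close`) is a case distinction on the bonus
of the item, which is large if the item does not fit into a bin that is not very full.

For the span of a colour, look at the items of one bin of the packing of that colour. Once one of
them opens a new bin of Bounded Best-Fit, the rest have room in that bin, so each bin of the packing
causes at most one new bin (`BBFRun.spread_le_succ`); the at most two bins already open when the
colour starts give the additive constant `2` on top of the bound for the APTAS.

For the APTAS (`IsVLPacking.length_le`), suppose `ε ≤ 1 / 2`. If First Fit opens no new bin, the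
number of bins is that of an optimal packing of the rounded items, which exceeds the optimum by at
most the size of one group (`exists_isPacking_rounded`). If First Fit opens a bin, all bins but one
have load more than `1 - ε`, and `1 / (1 - ε) ≤ 1 + 2 * ε`. If `ε > 1 / 2`, then a bin holding a
large item is more than half full, and First Fit keeps all bins but one more than half full.

The implementation is correct because a packing of the rounded items is, up to the choice of items
within a group, a multiset of bin types: every packing without empty bins is among the enumerated
combinations (`exists_combineT_eq`), and every enumerated combination that meets the demands can be
filled with the actual items (`fillT_spec`). It is polynomial because the number of groups and the
number of bin types depend only on `ε`, so that at most `(N + 1) ^ T` combinations are enumerated.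
-/

noncomputable section

namespace ColouredBinPacking

/-! ### The weight bonus -/

/-- The bonus of an item of size `x`: its weight is `6 / 5 * x + bonus x`. -/
def bonus (x : ℝ) : ℝ :=
  if x ≤ 1 / 6 then 0
  else if x ≤ 1 / 3 then 3 / 5 * (x - 1 / 6)
  else if x ≤ 1 / 2 then 1 / 10
  else 2 / 5

/-- The largest total bonus of a bin of load `t`. -/
def bonusCap (t : ℝ) : ℝ := if t ≤ 1 / 2 then bonus t else 2 / 5 + bonus (t - 1 / 2)

lemma bonus_nonneg (x : ℝ) : 0 ≤ bonus x := by
  unfold bonus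
  split_ifs <;> linarith

lemma bonus_le_of_le_half {x : ℝ} (hx : x ≤ 1 / 2) : bonus x ≤ 1 / 10 := by
  unfold bonus
  split_ifs <;> linarith

lemma bonus_add_le {x y : ℝ} (hx : 0 ≤ x) (hy : 0 ≤ y) (h : x + y ≤ 1 / 2) :
    bonus x + bonus y ≤ bonus (x + y) := by
  unfold bonus
  split_ifs <;> linarith

/-- A bin with an item of size more than `1 / 2` gains `2 / 5` from it, and the other items share a
load of less than `1 / 2`; hence `bonusCap` absorbs any item that fits. -/
lemma bonus_add_bonusCap_le {x t : ℝ} (hx : 0 ≤ x) (ht : 0 ≤ t) (h : x + t ≤ 1) :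
    bonus x + bonusCap t ≤ bonusCap (x + t) := by
  unfold bonusCap
  split_ifs with h1 h2 h2
  · exact bonus_add_le hx ht h2
  · rcases le_or_gt x (1 / 2) with h3 | h3
    · have := bonus_le_of_le_half h3
      have := bonus_le_of_le_half h1
      have := bonus_nonneg (x + t - 1 / 2)
      linarith
    · have h4 := bonus_add_le (x := x - 1 / 2) (y := t) (by linarith) ht (by linarith)
      have h5 : bonus x = 2 / 5 := by
        unfold bonus
        split_ifs <;> linarith
      have := bonus_nonneg (x - 1 / 2)
      rw [show x - 1 / 2 + t = x + t - 1 / 2 by ring] at h4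
      linarith
  · linarith
  · have h4 := bonus_add_le (x := x) (y := t - 1 / 2) hx (by linarith) (by linarith)
    rw [← add_sub_assoc] at h4
    linarith

lemma bonusCap_le {t : ℝ} (ht : t ≤ 1) : bonusCap t ≤ 1 / 2 := by
  unfold bonusCap
  split_ifs with h
  · linarith [bonus_le_of_le_half h]
  · linarith [bonus_le_of_le_half (x := t - 1 / 2) (by linarith)]

variable {ι : Type}

@[simp] lemma load_nil (s : ι → ℝ) : load s [] = 0 := rfl

@[simp] lemma load_cons (s : ι → ℝ) (e : ι) (B : List ι) : load s (e :: B) = s e + load s B := by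
  simp [load]

@[simp] lemma load_append (s : ι → ℝ) (B C : List ι) : load s (B ++ C) = load s B + load s C := by
  simp [load]

lemma load_nonneg {s : ι → ℝ} (hs : ∀ e, 0 ≤ s e) (B : List ι) : 0 ≤ load s B := by
  induction B with
  | nil => simp
  | cons e B ih => simpa using add_nonneg (hs e) ih

lemma load_perm {s : ι → ℝ} {B C : List ι} (h : B.Perm C) : load s B = load s C :=
  (h.map s).sum_eq

lemma load_bonus_le_bonusCap {s : ι → ℝ} (hs : ∀ e, 0 ≤ s e) (B : List ι) (hB : load s B ≤ 1) :
    load (fun e => bonus (s e)) B ≤ bonusCap (load s B) := by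
  induction B with
  | nil => simp [bonusCap, bonus]
  | cons e B ih =>
    rw [load_cons] at hB
    have h1 := bonus_add_bonusCap_le (hs e) (load_nonneg hs B) hB
    have h2 := ih (by linarith [hs e])
    simp only [load_cons]
    linarith

/-- The weight of a bin is at most `17 / 10`. -/
lemma weight_bin_le {s : ι → ℝ} (hs : ∀ e, 0 ≤ s e) {B : List ι} (hB : load s B ≤ 1) :
    6 / 5 * load s B + load (fun e => bonus (s e)) B ≤ 17 / 10 := by
  have h1 := load_bonus_le_bonusCap hs B hB
  have h2 := bonusCap_le hB
  linarith

lemma weight_flatten_le {s : ι → ℝ} (hs : ∀ e, 0 ≤ s e) {P : List (List ι)}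
    (hP : ∀ B ∈ P, load s B ≤ 1) :
    6 / 5 * load s P.flatten + load (fun e => bonus (s e)) P.flatten ≤ 17 / 10 * P.length := by
  induction P with
  | nil => simp
  | cons B P ih =>
    have h1 := weight_bin_le hs (hP B (by simp))
    have h2 := ih (fun C hC => hP C (by simp [hC]))
    simp only [List.flatten_cons, load_append, List.length_cons]
    push_cast
    linarith

/-! ### Packings and optima -/

lemma Enumerates.perm {l l' : List ι} {X : Finset ι} (h : Enumerates l X) (h' : Enumerates l' X) :
    l.Perm l' :=
  (List.perm_ext_iff_of_nodup h.1 h'.1).2 fun e => (h.2 e).trans (h'.2 e).symm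

lemma Enumerates.of_perm {l l' : List ι} {X : Finset ι} (h : Enumerates l X) (hp : l'.Perm l) :
    Enumerates l' X :=
  ⟨hp.nodup_iff.2 h.1, fun e => hp.mem_iff.trans (h.2 e)⟩

lemma enumerates_toList (X : Finset ι) : Enumerates X.toList X := ⟨X.nodup_toList, by simp⟩

lemma flatten_map_singleton (l : List ι) : (l.map fun e => [e]).flatten = l := by
  induction l with
  | nil => rfl
  | cons e l ih => simp [ih]

lemma exists_isPacking_length_eq_OPT {s : ι → ℝ} {X : Finset ι} (hs : ∀ e ∈ X, s e ≤ 1) :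
    ∃ P, IsPacking s X P ∧ P.length = OPT s X := by
  have : (X.toList.map fun e => [e]).length ∈
      {k : ℕ | ∃ P : List (List ι), IsPacking s X P ∧ P.length = k} := by
    refine ⟨_, ⟨?_, ?_⟩, rfl⟩
    · rw [flatten_map_singleton]
      exact enumerates_toList X
    · simpa using hs
  exact Nat.sInf_mem ⟨_, this⟩

lemma weight_le_OPT {s : ι → ℝ} (hs : ∀ e, 0 ≤ s e) {X : Finset ι} (hs1 : ∀ e ∈ X, s e ≤ 1)
    {l : List ι} (hl : Enumerates l X) :
    6 / 5 * load s l + load (fun e => bonus (s e)) l ≤ 17 / 10 * OPT s X := by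
  obtain ⟨P, hP, hPl⟩ := exists_isPacking_length_eq_OPT hs1
  have hp := hl.perm hP.1
  rw [load_perm hp, load_perm hp, ← hPl]
  exact weight_flatten_le hs hP.2

lemma load_flatten_le_length {s : ι → ℝ} {P : List (List ι)} (hP : ∀ B ∈ P, load s B ≤ 1) :
    load s P.flatten ≤ P.length := by
  induction P with
  | nil => simp
  | cons B P ih =>
    have := hP B (by simp)
    have := ih fun C hC => hP C (by simp [hC])
    simp only [List.flatten_cons, load_append, List.length_cons]
    push_cast
    linarith

lemma load_le_OPT {s : ι → ℝ} {X : Finset ι} (hs1 : ∀ e ∈ X, s e ≤ 1)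
    {l : List ι} (hl : Enumerates l X) : load s l ≤ OPT s X := by
  obtain ⟨P, hP, hPl⟩ := exists_isPacking_length_eq_OPT hs1
  rw [load_perm (hl.perm hP.1), ← hPl]
  exact load_flatten_le_length hP.2

/-! ### Bounded Best-Fit with two open bins -/

/-- What two open bins of loads `a` and `b` owe: a lower bound for the bonuses still to come plus
the sum of `6 / 5 * x - 1` over the loads `x` of the bins still to be closed. A debt exists only if
both bins are more than half full; then the next bin to be closed is the fuller one, and the item
causing this brings a bonus of at least `min (1 / 10) (1 / 2 - 3 / 5 * min a b)`, since it does not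
fit into the other bin. -/
def potential (a b : ℝ) : ℝ :=
  if min a b ≤ 1 / 2 then 0
  else min 0 (6 / 5 * max a b - 1 + min (1 / 10) (1 / 2 - 3 / 5 * min a b))

lemma potential_comm (a b : ℝ) : potential a b = potential b a := by
  simp only [potential, min_comm a b, max_comm a b]

lemma potential_nonpos (a b : ℝ) : potential a b ≤ 0 := by
  unfold potential
  split_ifs
  · exact le_rfl
  · exact min_le_left _ _

lemma potential_eq_zero {a b : ℝ} (hb : b ≤ 1 / 2) : potential a b = 0 :=
  if_pos ((min_le_right a b).trans hb)

lemma le_potential {a b c : ℝ} (hba : b ≤ a) (h0 : c ≤ 0)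
    (h : 1 / 2 < b → c ≤ 6 / 5 * a - 1 + 1 / 10 ∧ c ≤ 6 / 5 * a - 1 + (1 / 2 - 3 / 5 * b)) :
    c ≤ potential a b := by
  unfold potential
  rw [min_eq_right hba, max_eq_left hba]
  split_ifs with hb
  · exact h0
  · obtain ⟨h1, h2⟩ := h (not_le.1 hb)
    rw [← min_add_add_left]
    exact le_min h0 (le_min h1 h2)

lemma potential_le {a b : ℝ} (hba : b ≤ a) (hb : 1 / 2 < b) :
    potential a b ≤ 6 / 5 * a - 1 + 1 / 10 ∧
      potential a b ≤ 6 / 5 * a - 1 + (1 / 2 - 3 / 5 * b) := by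
  unfold potential
  rw [min_eq_right hba, max_eq_left hba, if_neg (not_le.2 hb), ← min_add_add_left]
  exact ⟨(min_le_right _ _).trans (min_le_left _ _), (min_le_right _ _).trans (min_le_right _ _)⟩

lemma min_le_bonus (x : ℝ) : min (1 / 10) (3 / 5 * (x - 1 / 6)) ≤ bonus x := by
  unfold bonus
  split_ifs <;> simp only [min_le_iff] <;> first | (right; linarith) | (left; linarith)

lemma bonus_of_half_lt {x : ℝ} (hx : 1 / 2 < x) : bonus x = 2 / 5 := by
  unfold bonus
  split_ifs <;> linarith

/-- An item put into the bin of load `a` respects the potential. It can go to the emptier bin only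
if it does not fit into the fuller one, and then its bonus pays for the change. -/
lemma potential_fit {a b x : ℝ} (hab : 1 < a + b) (hb1 : b ≤ 1) (hx : 0 ≤ x)
    (hfull : b + x ≤ 1 → b ≤ a) : potential a b ≤ bonus x + potential (a + x) b := by
  rw [← sub_le_iff_le_add']
  have h0 := potential_nonpos a b
  have h1 := bonus_nonneg x
  rcases le_or_gt b a with hba | hba
  · refine le_potential (by linarith) (by linarith) fun hb => ?_
    obtain ⟨h2, h3⟩ := potential_le hba hb
    constructor <;> linarith
  · have hbx : 1 < b + x := by
      by_contra h
      linarith [hfull (not_lt.1 h)]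
    have hx' := min_le_bonus x
    rcases le_or_gt b (a + x) with hbax | hbax
    · refine le_potential hbax (by linarith) fun hb => ?_
      rcases min_le_iff.1 hx' with h | h <;> constructor <;> linarith
    · rw [potential_comm (a + x)]
      refine le_potential hbax.le (by linarith) fun hb => ?_
      rcases le_or_gt a (1 / 2) with ha | ha
      · rcases min_le_iff.1 hx' with h | h <;> constructor <;> linarith
      · rw [potential_comm]
        rw [potential_comm] at h0
        obtain ⟨h2, h3⟩ := potential_le hba.le ha
        rcases min_le_iff.1 hx' with h | h <;> constructor <;> linarith

/-- The step from one open bin, of load `b`, to two. -/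
lemma potential_new {b x : ℝ} (hb1 : b ≤ 1) :
    0 ≤ bonus x + potential x b := by
  rcases le_or_gt x (1 / 2) with h | h
  · rw [potential_comm, potential_eq_zero h, add_zero]
    exact bonus_nonneg x
  · rw [bonus_of_half_lt h, ← neg_le_iff_add_nonneg']
    rcases le_total b x with hbx | hbx
    · exact le_potential hbx (by linarith) fun hb => by constructor <;> linarith
    · rw [potential_comm]
      exact le_potential hbx (by linarith) fun hb => by constructor <;> linarith

/-- Closing the fuller bin, of load `a`, to open one for an item that does not fit into the other
bin respects the potential. -/
lemma potential_close {a b x : ℝ} (hx : x ≤ 1) (hba : b ≤ a) (hab : 1 < a + b)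
    (hbx : 1 < b + x) : potential a b ≤ bonus x + (6 / 5 * a - 1) + potential x b := by
  rw [← sub_le_iff_le_add']
  have h0 := potential_nonpos a b
  have h1 := min_le_bonus x
  rcases le_or_gt b (1 / 2) with hb | hb
  · rw [potential_eq_zero hb, potential_eq_zero hb, bonus_of_half_lt (by linarith)]
    linarith
  obtain ⟨h2, h3⟩ := potential_le hba hb
  rcases le_or_gt x (1 / 2) with h | h
  · rw [potential_comm x, potential_eq_zero h]
    rcases min_le_iff.1 h1 with h | h <;> linarith
  · rw [bonus_of_half_lt h]
    rcases le_total b x with hbx | hbx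
    · exact le_potential hbx (by linarith) fun hb => by constructor <;> linarith
    · rw [potential_comm x]
      exact le_potential hbx (by linarith) fun hb => by constructor <;> linarith

lemma BBFRun.induction {s : ι → ℝ} {k : ℕ} {p : BBFState ι → List ι → Prop}
    (hstep : ∀ σ l e τ, p σ l → BBFStep s k σ e τ → p τ (l ++ [e]))
    {σ τ : BBFState ι} {l l' : List ι} (hr : BBFRun s k σ l' τ) (h : p σ l) : p τ (l ++ l') := by
  induction hr generalizing l with
  | nil σ => simpa using h
  | cons σ τ υ e l' hs _ ih => simpa using ih (hstep _ _ _ _ h hs)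

lemma BBFRun.append {s : ι → ℝ} {k : ℕ} {σ τ : BBFState ι} {l l' : List ι}
    (h : BBFRun s k σ (l ++ l') τ) : ∃ υ, BBFRun s k σ l υ ∧ BBFRun s k υ l' τ := by
  induction l generalizing σ with
  | nil => exact ⟨σ, .nil σ, h⟩
  | cons e l ih =>
    cases h with
    | cons _ τ' _ _ _ hs hr =>
      obtain ⟨υ, h1, h2⟩ := ih hr
      exact ⟨υ, .cons _ _ _ _ _ hs h1, h2⟩

/-- All bins of a state. -/
def BBFState.bins (σ : BBFState ι) : List (List ι) := σ.closed ++ σ.opened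

/-- The state describes a packing of the items `l` in which at most `k` bins are open. -/
structure BBFState.Packs (s : ι → ℝ) (k : ℕ) (σ : BBFState ι) (l : List ι) : Prop where
  perm : σ.bins.flatten.Perm l
  load_le : ∀ B ∈ σ.bins, load s B ≤ 1
  opened_le : σ.opened.length ≤ k

lemma BBFState.Packs.step {s : ι → ℝ} (hs : ∀ e, s e ≤ 1) {k : ℕ} {σ τ : BBFState ι}
    {l : List ι} {e : ι} (h : σ.Packs s k l) (hst : BBFStep s k σ e τ) :
    τ.Packs s k (l ++ [e]) := by
  obtain ⟨h1, h2, h3⟩ := h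
  simp only [BBFState.bins] at h1 h2
  cases hst with
  | fit cl op e B rest hp hB _ =>
    have hp' : (cl ++ op).Perm (B :: (cl ++ rest)) :=
      (hp.append_left cl).trans List.perm_middle
    refine ⟨?_, ?_, ?_⟩
    · simp only [BBFState.bins]
      have h4 : (cl ++ ((B ++ [e]) :: rest)).flatten.Perm
          ((B ++ [e]) :: (cl ++ rest)).flatten := List.perm_middle.flatten
      have h5 := h1.symm.trans hp'.flatten
      refine h4.trans (List.Perm.trans ?_ (h5.symm.append_right [e]))
      simp only [List.flatten_cons, List.append_assoc]
      exact List.Perm.append_left B List.perm_append_comm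
    · simp only [BBFState.bins]
      intro C hC
      simp only [List.mem_append, List.mem_cons] at hC
      rcases hC with hC | rfl | hC
      · exact h2 C (by simp [hC])
      · simpa using hB
      · exact h2 C (hp'.mem_iff.2 (by simp [hC]))
    · simpa [hp.length_eq] using h3
  | new cl op e _ hlt =>
    refine ⟨?_, ?_, ?_⟩
    · simp only [BBFState.bins]
      have h4 : (cl ++ ([e] :: op)).flatten.Perm ([e] :: (cl ++ op)).flatten :=
        List.perm_middle.flatten
      refine h4.trans ?_
      simp only [List.flatten_cons]
      exact (h1.append_left [e]).trans List.perm_append_comm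
    · simp only [BBFState.bins]
      intro C hC
      simp only [List.mem_append, List.mem_cons] at hC
      rcases hC with hC | rfl | hC
      · exact h2 C (by simp [hC])
      · simpa using hs e
      · exact h2 C (by simp [hC])
    · simpa using hlt
  | close cl op e B rest _ hlen hp _ =>
    have hp' : (cl ++ op).Perm (B :: (cl ++ rest)) :=
      (hp.append_left cl).trans List.perm_middle
    refine ⟨?_, ?_, ?_⟩
    · simp only [BBFState.bins]
      have h4 : (B :: cl ++ ([e] :: rest)).flatten.Perm ([e] :: (B :: cl ++ rest)).flatten :=
        List.perm_middle.flatten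
      have h5 := h1.symm.trans hp'.flatten
      refine h4.trans ?_
      rw [List.flatten_cons]
      exact (h5.symm.append_left [e]).trans List.perm_append_comm
    · simp only [BBFState.bins]
      intro C hC
      simp only [List.mem_append, List.mem_cons] at hC
      rcases hC with (rfl | hC) | rfl | hC
      · exact h2 C (hp'.mem_iff.2 (by simp))
      · exact h2 C (by simp [hC])
      · simpa using hs e
      · exact h2 C (hp'.mem_iff.2 (by simp [hC]))
    · have := hp.length_eq
      simp only [List.length_cons] at this ⊢
      omega

lemma BBFRun.packs {s : ι → ℝ} (hs : ∀ e, s e ≤ 1) {k : ℕ} {σ : BBFState ι}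
    {l : List ι} (h : BBFRun s k ⟨[], []⟩ l σ) : σ.Packs s k l := by
  have := h.induction (p := fun σ l => σ.Packs s k l) (l := [])
    (fun σ l e τ h hst => h.step hs hst) ⟨by simp [BBFState.bins], by simp [BBFState.bins], by simp⟩
  simpa using this

/-- The potential of the open bins, `0` unless there are two of them. -/
def openPotential (s : ι → ℝ) : List (List ι) → ℝ
  | [B, C] => potential (load s B) (load s C)
  | _ => 0

lemma openPotential_nonpos (s : ι → ℝ) (op : List (List ι)) : openPotential s op ≤ 0 := by
  unfold openPotential
  split
  · exact potential_nonpos _ _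
  · exact le_rfl

/-- The invariant of Bounded Best-Fit with two open bins that bounds the number of closed bins by
the weight of the items packed so far. -/
structure BBFState.Weighs (s : ι → ℝ) (σ : BBFState ι) (l : List ι) : Prop where
  /-- `σ.closed.flatten` lists the items in closed bins, `l` lists all items packed so far. -/
  closed_le : (σ.closed.length : ℝ) ≤ 6 / 5 * load s σ.closed.flatten
    + load (fun e => bonus (s e)) l + openPotential s σ.opened
  /-- Two open bins hold more than `1` in total: a new one is opened only for lack of room. -/
  one_lt : ∀ B C, σ.opened = [B, C] → 1 < load s B + load s C

lemma openPotential_perm {s : ι → ℝ} {op op' : List (List ι)} (h : op.Perm op') :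
    openPotential s op = openPotential s op' := by
  match op, op', h with
  | [], op', h => rw [List.nil_perm.1 h]
  | [B], op', h => rw [List.singleton_perm.1 h]
  | [B, C], op', h =>
    rcases List.perm_pair.1 h.symm with rfl | rfl
    · rfl
    · exact potential_comm _ _
  | B :: C :: D :: op, op', h => 
    have := h.length_eq
    match op', this with
    | _ :: _ :: _ :: _, _ => rfl

lemma BBFState.Weighs.step {s : ι → ℝ} (hs0 : ∀ e, 0 ≤ s e) (hs1 : ∀ e, s e ≤ 1)
    {σ τ : BBFState ι} {l : List ι} {e : ι} (hσ : σ.Packs s 2 l) (h : σ.Weighs s l)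
    (hst : BBFStep s 2 σ e τ) : τ.Weighs s (l ++ [e]) := by
  obtain ⟨h1, h2⟩ := h
  obtain ⟨-, h3, h4⟩ := hσ
  have hbe := bonus_nonneg (s e)
  cases hst with
  | fit cl op e B rest hp hB hbest =>
    simp only [BBFState.bins] at *
    rw [openPotential_perm hp] at h1
    match rest, hp with
    | [], hp =>
      refine ⟨?_, by simp⟩
      simp only [openPotential, load_append, load_cons, load_nil] at h1 ⊢
      linarith
    | [C], hp =>
      have hBC : 1 < load s B + load s C := by
        rcases List.perm_pair.1 hp with h | h
        · exact h2 _ _ h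
        · rw [add_comm]
          exact h2 _ _ h
      refine ⟨?_, ?_⟩
      · have hC1 := h3 C (by simp [hp.mem_iff])
        have := potential_fit hBC hC1 (hs0 e) (hbest C (by simp [hp.mem_iff]))
        simp only [openPotential, load_append, load_cons, load_nil, add_zero] at h1 ⊢
        linarith
      · intro B' C' h
        simp only [List.cons.injEq] at h
        obtain ⟨rfl, rfl, -⟩ := h
        simp only [load_append, load_cons, load_nil]
        linarith [hs0 e]
    | _ :: _ :: _, hp =>
      have := hp.length_eq
      simp at this h4
      omega
  | new cl op e hno hlt =>
    simp only [BBFState.bins] at *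
    match op, hlt with
    | [], _ =>
      refine ⟨?_, by simp⟩
      simp only [openPotential, load_append, load_cons, load_nil] at h1 ⊢
      linarith
    | [B], _ =>
      have hB := hno B (by simp)
      refine ⟨?_, ?_⟩
      · have := potential_new (x := s e) (h3 B (by simp))
        simp only [openPotential, load_append, load_cons, load_nil, add_zero] at h1 ⊢
        linarith
      · intro B' C' h
        simp only [List.cons.injEq] at h
        obtain ⟨rfl, rfl, -⟩ := h
        simp only [load_cons, load_nil]
        linarith
  | close cl op e B rest hno hlen hp hfull =>
    simp only [BBFState.bins] at *
    rw [openPotential_perm hp] at h1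
    have hlen' := hp.length_eq
    rw [hlen] at hlen'
    match rest, hp, hlen' with
    | [C], hp, _ =>
      have hBC : 1 < load s B + load s C := by
        rcases List.perm_pair.1 hp with h | h
        · exact h2 _ _ h
        · rw [add_comm]
          exact h2 _ _ h
      have hC := hno C (by simp [hp.mem_iff])
      refine ⟨?_, ?_⟩
      · have := potential_close (hs1 e)
          (hfull C (by simp [hp.mem_iff])) hBC hC
        simp only [openPotential, load_append, load_cons, load_nil, add_zero, List.flatten_cons,
          List.length_cons] at h1 ⊢
        push_cast
        linarith
      · intro B' C' h
        simp only [List.cons.injEq] at h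
        obtain ⟨rfl, rfl, -⟩ := h
        simp only [load_cons, load_nil]
        linarith

lemma BBFRun.length_bins_le {s : ι → ℝ} (hs0 : ∀ e, 0 ≤ s e) (hs1 : ∀ e, s e ≤ 1)
    {σ : BBFState ι} {l : List ι} (h : BBFRun s 2 ⟨[], []⟩ l σ) :
    (σ.bins.length : ℝ) ≤ 6 / 5 * load s l + load (fun e => bonus (s e)) l + 2 := by
  have hp := h.packs hs1
  have hw := h.induction (p := fun σ l => σ.Packs s 2 l ∧ σ.Weighs s l) (l := [])
    (fun σ l e τ h hst => ⟨h.1.step hs1 hst, h.2.step hs0 hs1 h.1 hst⟩)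
    ⟨⟨by simp [BBFState.bins], by simp [BBFState.bins], by simp⟩, by simp [openPotential], by simp⟩
  have h1 := hw.2.closed_le
  have h2 := openPotential_nonpos s σ.opened
  have h3 : (σ.opened.length : ℝ) ≤ 2 := by exact_mod_cast hp.opened_le
  have h4 : load s σ.closed.flatten ≤ load s l := by
    rw [← load_perm hp.perm, BBFState.bins, List.flatten_append, load_append]
    linarith [load_nonneg hs0 σ.opened.flatten]
  simp only [List.nil_append] at h1
  simp only [BBFState.bins, List.length_append]
  push_cast
  linarith

/-! ### How far Bounded Best-Fit spreads the bins of a packing -/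

/-- The number of closed bins with the property `p` plus the number of all open bins. It grows only
when a new bin is opened. -/
def BBFState.spread (p : List ι → Bool) (σ : BBFState ι) : ℕ :=
  σ.closed.countP p + σ.opened.length

lemma countP_bins_le_spread (p : List ι → Bool) (σ : BBFState ι) :
    σ.bins.countP p ≤ σ.spread p := by
  simp only [BBFState.bins, BBFState.spread, List.countP_append]
  exact Nat.add_le_add_left List.countP_le_length _

/-- While all items still to come fit together into one of the open bins, no bin is opened. -/
lemma BBFRun.spread_le_of_fits {s : ι → ℝ} (hs0 : ∀ e, 0 ≤ s e) {k : ℕ} (p : List ι → Bool)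
    {σ τ : BBFState ι} {l : List ι} (h : BBFRun s k σ l τ) {D : List ι} (hD : D ∈ σ.opened)
    (hl : load s D + load s l ≤ 1) : τ.spread p ≤ σ.spread p := by
  induction h generalizing D with
  | nil σ => exact le_rfl
  | cons σ τ υ e l hst _ ih =>
    have hl0 := load_nonneg hs0 l
    rw [load_cons] at hl
    cases hst with
    | fit cl op e B rest hp hB hbest =>
      have h1 : (BBFState.mk cl ((B ++ [e]) :: rest)).spread p = (BBFState.mk cl op).spread p := by
        simp [BBFState.spread, hp.length_eq]
      rw [← h1]
      rcases List.mem_cons.1 (hp.mem_iff.1 hD) with rfl | hD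
      · refine ih (D := D ++ [e]) (by simp) ?_
        simp only [load_append, load_cons, load_nil]
        linarith
      · exact ih (D := D) (by simp [hD]) (by linarith [hs0 e])
    | new cl op e hno _ => exact absurd (hno D hD) (by linarith)
    | close cl op e B rest hno _ _ _ => exact absurd (hno D hD) (by linarith)

/-- The items of a single bin of a packing cause at most one bin to be opened: once one of them has
opened a bin, the others have room in it. -/
lemma BBFRun.spread_le_succ {s : ι → ℝ} (hs0 : ∀ e, 0 ≤ s e) {k : ℕ} (p : List ι → Bool)
    {σ τ : BBFState ι} {l : List ι} (h : BBFRun s k σ l τ) (hl : load s l ≤ 1) :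
    τ.spread p ≤ σ.spread p + 1 := by
  induction h with
  | nil σ => exact Nat.le_succ _
  | cons σ τ υ e l hst hr ih =>
    rw [load_cons] at hl
    cases hst with
    | fit cl op e B rest hp hB hbest =>
      have h1 : (BBFState.mk cl ((B ++ [e]) :: rest)).spread p = (BBFState.mk cl op).spread p := by
        simp [BBFState.spread, hp.length_eq]
      rw [← h1]
      exact ih (by linarith [hs0 e])
    | new cl op e _ _ =>
      refine (hr.spread_le_of_fits hs0 p (D := [e]) (by simp) (by simpa using hl)).trans ?_
      simp only [BBFState.spread, List.length_cons]
      omega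
    | close cl op e B rest _ _ hp _ =>
      refine (hr.spread_le_of_fits hs0 p (D := [e]) (by simp) (by simpa using hl)).trans ?_
      simp only [BBFState.spread, List.length_cons, hp.length_eq, List.countP_cons]
      split_ifs <;> omega

lemma BBFRun.spread_le_add_length {s : ι → ℝ} (hs0 : ∀ e, 0 ≤ s e) {k : ℕ} (p : List ι → Bool)
    {σ τ : BBFState ι} {P : List (List ι)} (h : BBFRun s k σ P.flatten τ)
    (hP : ∀ B ∈ P, load s B ≤ 1) : τ.spread p ≤ σ.spread p + P.length := by
  induction P generalizing σ with
  | nil =>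
    cases h
    simp
  | cons B P ih =>
    obtain ⟨υ, h1, h2⟩ := BBFRun.append h
    have h3 := h1.spread_le_succ hs0 p (hP B (by simp))
    have h4 := ih h2 fun C hC => hP C (by simp [hC])
    simp only [List.length_cons]
    omega

/-- Items without the property `q` do not change the number of bins that hold an item with `q`. -/
lemma BBFRun.countP_any_eq {s : ι → ℝ} {k : ℕ} (q : ι → Bool)
    {σ τ : BBFState ι} {l : List ι} (h : BBFRun s k σ l τ) (hl : ∀ e ∈ l, q e = false) :
    τ.bins.countP (fun B => B.any q) = σ.bins.countP (fun B => B.any q) := by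
  induction h with
  | nil σ => rfl
  | cons σ τ υ e l hst hr ih =>
    rw [ih fun f hf => hl f (by simp [hf])]
    have he := hl e (by simp)
    cases hst with
    | fit cl op e B rest hp hB hbest =>
      simp [BBFState.bins, hp.countP_eq, List.countP_cons, he]
    | new cl op e _ _ => simp [BBFState.bins, he]
    | close cl op e B rest _ _ hp _ =>
      simp [BBFState.bins, hp.countP_eq, List.countP_cons, he]
      omega

/-- If the items with the property `q` come consecutively, in the order of a packing `P` of them,
then they are spread over at most two more bins than `P` has. -/
lemma BBFRun.countP_any_le {s : ι → ℝ} (hs0 : ∀ e, 0 ≤ s e) (hs1 : ∀ e, s e ≤ 1) {k : ℕ}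
    (q : ι → Bool) {σ : BBFState ι} {l₁ l₂ : List ι} {P : List (List ι)}
    (h : BBFRun s k ⟨[], []⟩ (l₁ ++ P.flatten ++ l₂) σ) (h₁ : ∀ e ∈ l₁, q e = false)
    (h₂ : ∀ e ∈ l₂, q e = false) (hP : ∀ B ∈ P, load s B ≤ 1) :
    σ.bins.countP (fun B => B.any q) ≤ P.length + k := by
  obtain ⟨υ, h3, h4⟩ := BBFRun.append h
  obtain ⟨τ, h5, h6⟩ := BBFRun.append h3
  rw [h4.countP_any_eq q h₂]
  refine (countP_bins_le_spread _ _).trans ((h6.spread_le_add_length hs0 _ hP).trans ?_)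
  have h7 := h5.countP_any_eq q h₁
  have h8 := (h5.packs hs1).opened_le
  simp only [BBFState.bins, List.countP_append, List.append_nil, List.countP_nil] at h7
  simp only [BBFState.spread]
  omega

/-! ### First Fit -/

lemma firstFitItem_flatten_perm (s : ι → ℝ) (e : ι) (P : List (List ι)) :
    (firstFitItem s e P).flatten.Perm (P.flatten ++ [e]) := by
  induction P with
  | nil => simp [firstFitItem]
  | cons B P ih =>
    rw [firstFitItem]
    split_ifs with h
    · simp only [List.flatten_cons, List.append_assoc]
      exact List.Perm.append_left B List.perm_append_comm
    · simp only [List.flatten_cons, List.append_assoc]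
      exact ih.append_left B

lemma load_firstFitItem_le {s : ι → ℝ} {e : ι} (he : s e ≤ 1) {P : List (List ι)}
    (hP : ∀ B ∈ P, load s B ≤ 1) : ∀ B ∈ firstFitItem s e P, load s B ≤ 1 := by
  induction P with
  | nil => simpa [firstFitItem] using he
  | cons B P ih =>
    have hP' : ∀ C ∈ P, load s C ≤ 1 := fun C hC => hP C (by simp [hC])
    rw [firstFitItem]
    split_ifs with h
    · intro C hC
      rcases List.mem_cons.1 hC with rfl | hC
      · simpa using h
      · exact hP' C hC
    · intro C hC
      rcases List.mem_cons.1 hC with rfl | hC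
      · exact hP C (by simp)
      · exact ih hP' C hC

/-- First Fit either opens a new bin, the item fitting nowhere else, or adds the item to a bin. -/
lemma firstFitItem_cases {s : ι → ℝ} {e : ι} (he : 0 ≤ s e) (θ : ℝ) (P : List (List ι)) :
    (firstFitItem s e P = P ++ [[e]] ∧ ∀ B ∈ P, 1 < load s B + s e) ∨
    ((firstFitItem s e P).length = P.length ∧
      (firstFitItem s e P).countP (fun B => load s B ≤ θ) ≤ P.countP (fun B => load s B ≤ θ)) := by
  induction P with
  | nil => simp [firstFitItem]
  | cons B P ih =>
    rw [firstFitItem]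
    split_ifs with h
    · right
      refine ⟨by simp, ?_⟩
      simp only [List.countP_cons, load_append, load_cons, load_nil, decide_eq_true_eq]
      split_ifs <;> first | omega | (exfalso; linarith)
    · rcases ih with ⟨h1, h2⟩ | ⟨h1, h2⟩
      · left
        rw [h1]
        exact ⟨rfl, by simpa using ⟨not_le.1 h, h2⟩⟩
      · right
        refine ⟨by simp [h1], ?_⟩
        simp only [List.countP_cons]
        omega

lemma firstFit_flatten_perm (s : ι → ℝ) (S : List ι) (P : List (List ι)) :
    (firstFit s P S).flatten.Perm (P.flatten ++ S) := by
  induction S generalizing P with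
  | nil => simp [firstFit]
  | cons e S ih =>
    refine (ih (firstFitItem s e P)).trans ?_
    refine ((firstFitItem_flatten_perm s e P).append_right S).trans ?_
    simp

lemma load_firstFit_le {s : ι → ℝ} (hs : ∀ e, s e ≤ 1) (S : List ι) {P : List (List ι)}
    (hP : ∀ B ∈ P, load s B ≤ 1) : ∀ B ∈ firstFit s P S, load s B ≤ 1 := by
  induction S generalizing P with
  | nil => simpa [firstFit] using hP
  | cons e S ih => exact ih (load_firstFitItem_le (hs e) hP)

/-- If First Fit opens new bins for items of size less than `ε`, then all bins but one end up with
load greater than `1 - ε`. -/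
lemma firstFit_small {s : ι → ℝ} (hs : ∀ e, 0 ≤ s e) {ε : ℝ} (n : ℕ) (S : List ι)
    (hS : ∀ e ∈ S, s e < ε) {P : List (List ι)}
    (hP : P.length ≤ n ∨ P.countP (fun B => load s B ≤ 1 - ε) ≤ 1) :
    (firstFit s P S).length ≤ n ∨
      (firstFit s P S).countP (fun B => load s B ≤ 1 - ε) ≤ 1 := by
  induction S generalizing P with
  | nil => exact hP
  | cons e S ih =>
    refine ih (P := firstFitItem s e P) (fun f hf => hS f (by simp [hf])) ?_
    rcases firstFitItem_cases (hs e) (1 - ε) P with ⟨h1, h2⟩ | ⟨h1, h2⟩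
    · right
      have h3 : P.countP (fun B => load s B ≤ 1 - ε) = 0 := by
        rw [List.countP_eq_zero]
        intro B hB
        have := h2 B hB
        have := hS e (by simp)
        simp only [decide_eq_true_eq]
        linarith
      rw [h1, List.countP_append, h3, zero_add]
      exact List.countP_le_length
    · omega

/-- First Fit preserves the property that at most one bin is at most half full. -/
lemma firstFit_half {s : ι → ℝ} (hs : ∀ e, 0 ≤ s e) (S : List ι) {P : List (List ι)}
    (hP : P.countP (fun B => load s B ≤ 1 / 2) ≤ 1) :
    (firstFit s P S).countP (fun B => load s B ≤ 1 / 2) ≤ 1 := by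
  induction S generalizing P with
  | nil => exact hP
  | cons e S ih =>
    refine ih (P := firstFitItem s e P) ?_
    rcases firstFitItem_cases (hs e) (1 / 2) P with ⟨h1, h2⟩ | ⟨h1, h2⟩
    · rw [h1, List.countP_append]
      rcases le_or_gt (s e) (1 / 2) with he | he
      · have h3 : P.countP (fun B => load s B ≤ 1 / 2) = 0 := by
          rw [List.countP_eq_zero]
          intro B hB
          have := h2 B hB
          simp only [decide_eq_true_eq]
          linarith
        rw [h3, zero_add]
        exact List.countP_le_length
      · have h4 : [[e]].countP (fun B => load s B ≤ 1 / 2) = 0 := by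
          rw [List.countP_eq_zero]
          simp only [List.mem_singleton, decide_eq_true_eq]
          rintro B rfl
          simpa only [load_cons, load_nil, add_zero, not_le] using he
        omega
    · omega

lemma mul_length_sub_countP_le {s : ι → ℝ} (hs : ∀ e, 0 ≤ s e) {θ : ℝ} (P : List (List ι)) :
    θ * (P.length - P.countP (fun B => load s B ≤ θ)) ≤ load s P.flatten := by
  induction P with
  | nil => simp
  | cons B P ih =>
    have hB := load_nonneg hs B
    simp only [List.length_cons, List.countP_cons, List.flatten_cons, load_append,
      decide_eq_true_eq]
    split_ifs with h <;> push_cast <;> linarith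

/-! ### The APTAS -/

lemma groups_flatten (q K : ℕ) (L : List ι) : (groups q K L).flatten = L.take (K * q) := by
  induction K generalizing L with
  | zero => simp [groups]
  | succ K ih =>
    rw [groups, List.flatten_cons, ih, add_mul, one_mul, add_comm (K * q), List.take_add]

lemma le_numGroups_mul {ε : ℝ} (hε : 0 < ε) (N : ℕ) : N ≤ ⌈1 / ε ^ 2⌉₊ * ⌈(N : ℝ) * ε ^ 2⌉₊ := by
  have h1 := Nat.le_ceil (1 / ε ^ 2)
  have h2 := Nat.le_ceil ((N : ℝ) * ε ^ 2)
  have h3 := mul_le_mul h1 h2 (by positivity) (by positivity)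
  have h4 : 1 / ε ^ 2 * ((N : ℝ) * ε ^ 2) = N := by field_simp
  rw [h4] at h3
  exact_mod_cast h3

lemma groups_flatten_eq {ε : ℝ} (hε : 0 < ε) (L : List ι) :
    (groups ⌈(L.length : ℝ) * ε ^ 2⌉₊ ⌈1 / ε ^ 2⌉₊ L).flatten = L := by
  rw [groups_flatten, List.take_of_length_le (le_numGroups_mul hε _)]

/-- The sizes of the items in the group of the `j`-th item are at most the size of the item that
comes `q` places later. -/
lemma exists_mem_groups {s : ι → ℝ} {q K : ℕ} {L : List ι} (hL : L.Pairwise (fun e f => s e ≤ s f))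
    {j : ℕ} (hj : j + q < L.length) (hjK : j < K * q) :
    ∃ g ∈ groups q K L, L[j] ∈ g ∧ ∀ y ∈ g, s y ≤ s L[j + q] := by
  induction K generalizing L j with
  | zero => simp at hjK
  | succ K ih =>
    rcases lt_or_ge j q with h | h
    · refine ⟨L.take q, by simp [groups], ?_, ?_⟩
      · rw [List.mem_take_iff_getElem]
        exact ⟨j, by omega, rfl⟩
      · intro y hy
        rw [List.mem_take_iff_getElem] at hy
        obtain ⟨i, hi, rfl⟩ := hy
        exact List.pairwise_iff_getElem.1 hL i (j + q) (by omega) hj (by omega)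
    · obtain ⟨g, hg, h1, h2⟩ := ih (L := L.drop q) (j := j - q)
        (hL.sublist (List.drop_sublist q L)) (by simp; omega) (by rw [add_mul] at hjK; omega)
      refine ⟨g, by simp [groups, hg], ?_, ?_⟩
      · simpa [Nat.add_sub_cancel' h] using h1
      · intro y hy
        have := h2 y hy
        rw [List.getElem_drop] at this
        convert this using 3
        omega

/-- Rounding up within groups of `q` items costs at most `q` bins: in a packing with the true sizes
put in the place of each large item the one that comes `q` places earlier, and put the last `q`
large items into bins of their own. -/
lemma exists_isPacking_rounded {s r : ι → ℝ} (hs : ∀ e, 0 ≤ s e) {X Y : Finset ι} (hYX : Y ⊆ X)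
    {P : List (List ι)} (hP : IsPacking s X P) {L : List ι} (hL : Enumerates L Y) (q : ℕ)
    (hr : ∀ j (h : j + q < L.length), r L[j] ≤ s L[j + q]) (hr1 : ∀ e ∈ L, r e ≤ 1) :
    ∃ Q, IsPacking r Y Q ∧ Q.length ≤ P.length + q := by
  classical
  -- `φ` replaces an item by the one `q` places earlier; `A` lists the items where this makes sense.
  set φ : ι → ι := fun x => L.getD (L.idxOf x - q) x with hφ
  set A := L.drop q with hA
  have hAnd : A.Nodup := hL.1.sublist (List.drop_sublist q L)
  have hAm : ∀ x ∈ A, ∃ j, ∃ h : j + q < L.length, x = L[j + q] ∧ φ x = L[j] := by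
    intro x hx
    obtain ⟨j, hj, rfl⟩ := List.mem_iff_getElem.1 hx
    simp only [hA, List.length_drop] at hj
    refine ⟨j, by omega, by simp [hA, add_comm], ?_⟩
    simp only [hφ, hA, List.getElem_drop]
    rw [hL.1.idxOf_getElem, Nat.add_sub_cancel_left, List.getD_eq_getElem]
  have hφA : A.map φ = L.take (L.length - q) := by
    apply List.ext_getElem
    · simp [hA]
    · intro i h1 h2
      simp only [hA, List.length_map, List.length_drop] at h1
      simp only [List.getElem_map, hA, List.getElem_drop, List.getElem_take, hφ]
      rw [hL.1.idxOf_getElem, Nat.add_sub_cancel_left, List.getD_eq_getElem]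
  have hload : ∀ B : List ι, load r ((B.filter (· ∈ A)).map φ) ≤ load s B := by
    intro B
    induction B with
    | nil => simp
    | cons x B ih =>
      by_cases hx : x ∈ A
      · obtain ⟨j, hj, hxj, hφx⟩ := hAm x hx
        have := hr j hj
        simp only [hx, decide_true, List.filter_cons_of_pos, List.map_cons, load_cons, hφx]
        rw [← hxj] at this
        linarith
      · simp only [hx, decide_false, Bool.false_eq_true, not_false_eq_true,
          List.filter_cons_of_neg, load_cons]
        linarith [hs x]
  refine ⟨P.map (fun B => (B.filter (· ∈ A)).map φ) ++ (L.drop (L.length - q)).map fun e => [e],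
    ⟨hL.of_perm ?_, ?_⟩, ?_⟩
  · have h1 : (P.map (fun B => (B.filter (· ∈ A)).map φ)).flatten
        = (P.flatten.filter (· ∈ A)).map φ := by
      rw [List.filter_flatten, List.map_flatten, List.map_map]
      rfl
    have h2 : (P.flatten.filter (· ∈ A)).Perm A := by
      rw [List.perm_ext_iff_of_nodup (hP.1.1.filter _) hAnd]
      intro x
      simp only [List.mem_filter, decide_eq_true_eq, and_iff_right_iff_imp]
      intro hx
      exact (hP.1.2 x).2 (hYX ((hL.2 x).1 ((List.drop_sublist q L).subset hx)))
    rw [List.flatten_append, h1, flatten_map_singleton]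
    refine ((h2.map φ).append_right _).trans ?_
    rw [hφA, List.take_append_drop]
  · intro B hB
    rcases List.mem_append.1 hB with hB | hB
    · obtain ⟨C, hC, rfl⟩ := List.mem_map.1 hB
      exact (hload C).trans (hP.2 C hC)
    · obtain ⟨e, he, rfl⟩ := List.mem_map.1 hB
      simpa using hr1 e ((List.drop_sublist _ L).subset he)
  · simp only [List.length_append, List.length_map, List.length_drop]
    omega

lemma mul_length_le_load {s : ι → ℝ} {ε : ℝ} {L : List ι} (h : ∀ e ∈ L, ε ≤ s e) :
    L.length * ε ≤ load s L := by
  induction L with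
  | nil => simp
  | cons e L ih =>
    have := ih fun f hf => h f (by simp [hf])
    have := h e (by simp)
    simp only [List.length_cons, load_cons]
    push_cast
    linarith

/-- Rounding up keeps sizes between the true size and `1`. -/
lemma rounded_bounds {s r : ι → ℝ} (hs1 : ∀ e, s e ≤ 1) {ε : ℝ} (hε : 0 < ε) {L : List ι}
    (hr : ∀ g ∈ groups ⌈(L.length : ℝ) * ε ^ 2⌉₊ ⌈1 / ε ^ 2⌉₊ L, ∀ e ∈ g,
      IsGreatest (s '' {x | x ∈ g}) (r e)) {e : ι} (he : e ∈ L) : s e ≤ r e ∧ r e ≤ 1 := by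
  rw [← groups_flatten_eq hε L] at he
  obtain ⟨g, hg, heg⟩ := List.mem_flatten.1 he
  obtain ⟨⟨x, -, hx⟩, h2⟩ := hr g hg e heg
  exact ⟨h2 ⟨e, heg, rfl⟩, hx ▸ hs1 x⟩

lemma load_le_load {s r : ι → ℝ} {B : List ι} (h : ∀ e ∈ B, s e ≤ r e) : load s B ≤ load r B :=
  List.sum_le_sum h

lemma IsVLPacking.isPacking {s : ι → ℝ} (hs1 : ∀ e, s e ≤ 1) {ε : ℝ} (hε : 0 < ε) {X : Finset ι}
    {P : List (List ι)} (h : IsVLPacking s ε X P) : IsPacking s X P := by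
  classical
  obtain ⟨L, S, r, Q, hL, -, hS, hr, hQ, -, rfl⟩ := h
  have hQL := hQ.1.perm hL
  constructor
  · refine Enumerates.of_perm (l := L ++ S) ⟨?_, ?_⟩
      ((firstFit_flatten_perm s S Q).trans (hQL.append_right S))
    · refine List.Nodup.append hL.1 hS.1 fun e he he' => ?_
      have h1 := (Finset.mem_filter.1 ((hL.2 e).1 he)).2
      have h2 := (Finset.mem_filter.1 ((hS.2 e).1 he')).2
      linarith
    · intro e
      rw [List.mem_append, hL.2, hS.2, Finset.mem_filter, Finset.mem_filter, ← and_or_left]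
      exact and_iff_left (le_or_gt _ _)
  · refine load_firstFit_le hs1 S fun B hB => (load_le_load fun e he => ?_).trans (hQ.2 B hB)
    exact (rounded_bounds hs1 hε hr (hQL.mem_iff.1 (List.mem_flatten.2 ⟨B, hB, he⟩))).1

lemma nil_not_mem_of_minimal {r : ι → ℝ} {Y : Finset ι} {Q : List (List ι)} (hQ : IsPacking r Y Q)
    (hmin : ∀ Q', IsPacking r Y Q' → Q.length ≤ Q'.length) : [] ∉ Q := by
  classical
  intro h
  have hp := List.perm_cons_erase h
  have h1 : IsPacking r Y (Q.erase []) :=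
    ⟨hQ.1.of_perm (by simpa using hp.flatten.symm), fun B hB => hQ.2 B (List.mem_of_mem_erase hB)⟩
  have h2 := hmin _ h1
  have h3 := hp.length_eq
  simp only [List.length_cons] at h3
  omega

/-- The bins of the APTAS: if First Fit opens no new bin, grouping loses at most `ε * OPT + 1` bins;
otherwise all bins but one are filled to more than `1 - ε`, and also to more than `1 / 2` if
`1 / 2 < ε`. -/
lemma IsVLPacking.length_le {s : ι → ℝ} (hs0 : ∀ e, 0 ≤ s e) (hs1 : ∀ e, s e ≤ 1) {ε : ℝ}
    (hε : 0 < ε) {X : Finset ι} {P : List (List ι)} (h : IsVLPacking s ε X P) :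
    (P.length : ℝ) ≤ (1 + 2 * ε) * OPT s X + 1 := by
  have hP := h.isPacking hs1 hε
  have hload := load_le_OPT (s := s) (fun e _ => hs1 e) hP.1
  obtain ⟨L, S, r, Q, hL, hsort, hS, hr, hQ, hmin, rfl⟩ := h
  have hOPT : (0 : ℝ) ≤ OPT s X := by positivity
  have hlarge : ∀ e ∈ L, ε ≤ s e := fun e he => (Finset.mem_filter.1 ((hL.2 e).1 he)).2
  have hsmall : ∀ e ∈ S, s e < ε := fun e he => (Finset.mem_filter.1 ((hS.2 e).1 he)).2
  have hcount : ∀ θ : ℝ, 0 ≤ θ → (firstFit s Q S).countP (fun B => load s B ≤ θ) ≤ 1 →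
      θ * ((firstFit s Q S).length - 1) ≤ OPT s X := by
    intro θ hθ hc
    have h1 := mul_length_sub_countP_le hs0 (θ := θ) (firstFit s Q S)
    have h2 : ((firstFit s Q S).countP (fun B => load s B ≤ θ) : ℝ) ≤ 1 := by exact_mod_cast hc
    refine le_trans ?_ (h1.trans hload)
    gcongr
  rcases le_or_gt ε (1 / 2) with hε2 | hε2
  · rcases firstFit_small hs0 Q.length S hsmall (.inl le_rfl) with h | h
    · obtain ⟨P₀, hP₀, hP₀l⟩ := exists_isPacking_length_eq_OPT (s := s) (X := X) fun e _ => hs1 e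
      set q := ⌈(L.length : ℝ) * ε ^ 2⌉₊ with hq
      obtain ⟨Q', hQ', hQl⟩ := exists_isPacking_rounded hs0 (Finset.filter_subset _ X) hP₀ hL q
        (r := r) (fun j hj => by
          obtain ⟨g, hg, h1, h2⟩ := exists_mem_groups (K := ⌈1 / ε ^ 2⌉₊) hsort hj (by
            have := le_numGroups_mul hε L.length
            rw [← hq] at this
            omega)
          obtain ⟨⟨x, hx, hxr⟩, -⟩ := hr g hg _ h1
          rw [← hxr]
          exact h2 x hx) (fun e he => (rounded_bounds hs1 hε hr he).2)
      have h1 := (h.trans (hmin Q' hQ')).trans hQl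
      rw [hP₀l] at h1
      have h2 : ((firstFit s Q S).length : ℝ) ≤ OPT s X + q := by exact_mod_cast h1
      have h3 : (q : ℝ) < L.length * ε ^ 2 + 1 := Nat.ceil_lt_add_one (by positivity)
      -- The `L.length` large items alone have total size at least `L.length * ε`.
      have h4 : L.length * ε ≤ OPT s X := by
        refine (mul_length_le_load hlarge).trans (le_trans ?_ hload)
        have h5 := (firstFit_flatten_perm s S Q).trans ((hQ.1.perm hL).append_right S)
        rw [load_perm h5, load_append]
        linarith [load_nonneg hs0 S]
      have h5 : L.length * ε ^ 2 ≤ ε * OPT s X := by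
        rw [pow_two, ← mul_assoc, mul_comm ε]
        gcongr
      nlinarith
    · have h1 := hcount (1 - ε) (by linarith) h
      have h2 : (1 : ℝ) ≤ (1 + 2 * ε) * (1 - ε) := by nlinarith
      have h3 := mul_le_mul_of_nonneg_left h1 (a := 1 + 2 * ε) (by linarith)
      rw [← mul_assoc] at h3
      have h4 : (0 : ℝ) ≤ (firstFit s Q S).length := by positivity
      rcases le_or_gt ((firstFit s Q S).length : ℝ) 1 with h5 | h5
      · nlinarith
      · nlinarith
  · -- Every bin of `Q` is nonempty by minimality, so it holds an item of size at least `ε > 1 / 2`.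
    have h0 : Q.countP (fun B => load s B ≤ 1 / 2) ≤ 1 := by
      rw [List.countP_eq_zero.2]
      · exact Nat.zero_le _
      intro B hB
      have hne : B ≠ [] := fun h => nil_not_mem_of_minimal hQ hmin (h ▸ hB)
      obtain ⟨e, he⟩ := List.exists_mem_of_ne_nil B hne
      have h1 := hlarge e (((hQ.1.perm hL).mem_iff).1 (List.mem_flatten.2 ⟨B, hB, he⟩))
      obtain ⟨B₁, B₂, rfl⟩ := List.append_of_mem he
      have := load_nonneg hs0 B₁
      have := load_nonneg hs0 B₂
      simp only [load_append, load_cons, decide_eq_true_eq]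
      linarith
    have h1 := hcount (1 / 2) (by norm_num) (firstFit_half hs0 S h0)
    nlinarith

/-! ### The bounds for the outputs -/

lemma flatten_flatMap {α β : Type} (l : List α) (f : α → List (List β)) :
    (l.flatMap f).flatten = l.flatMap fun a => (f a).flatten := by
  induction l with
  | nil => rfl
  | cons a l ih => simp [ih]

lemma ColouredInstance.mem_ofColour {n m : ℕ} {I : ColouredInstance n m} {c : Fin m} {e : Fin n} :
    e ∈ I.ofColour c ↔ I.colour e = c := by
  simp [ColouredInstance.ofColour]

lemma enumerates_flatMap {n m : ℕ} {I : ColouredInstance n m} {colours : List (Fin m)}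
    (hc : Enumerates colours Finset.univ) {P : Fin m → List (List (Fin n))}
    (hP : ∀ c, Enumerates (P c).flatten (I.ofColour c)) :
    Enumerates (colours.flatMap P).flatten Finset.univ := by
  rw [flatten_flatMap]
  refine ⟨List.nodup_flatMap.2 ⟨fun c _ => (hP c).1, hc.1.imp fun {c d} hcd e he he' => ?_⟩,
    fun e => ?_⟩
  · rw [(hP _).2, ColouredInstance.mem_ofColour] at he he'
    exact hcd (he.symm.trans he')
  · simp only [List.mem_flatMap, Finset.mem_univ, iff_true]
    exact ⟨I.colour e, (hc.2 _).2 (Finset.mem_univ _), ((hP _).2 e).2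
      (ColouredInstance.mem_ofColour.2 rfl)⟩

lemma IsOutput.bounds {ε : ℝ} (hε : 0 < ε) {n m : ℕ} {I : ColouredInstance n m}
    {P' : List (List (Fin n))} (h : IsOutput ε n m I P') :
    IsPacking I.size Finset.univ P' ∧
      (∀ c : Fin m, (span I P' c : ℝ) ≤ (1 + 2 * ε) * (OPT I.size (I.ofColour c) : ℝ) + 3) ∧
      (P'.length : ℝ) ≤ 1.7 * (OPT I.size Finset.univ : ℝ) + 2 := by
  obtain ⟨colours, P, σ, hc, hP, hσ, rfl⟩ := h
  have hs0 : ∀ e, 0 ≤ I.size e := fun e => (I.size_pos e).le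
  have hs1 := I.size_le_one
  have hpack := fun c => (hP c).isPacking hs1 hε
  have hen := enumerates_flatMap hc fun c => (hpack c).1
  have hσp := hσ.packs hs1
  refine ⟨⟨hen.of_perm hσp.perm, hσp.load_le⟩, fun c => ?_, ?_⟩
  · obtain ⟨l₁, l₂, hl⟩ := List.append_of_mem ((hc.2 c).2 (Finset.mem_univ c))
    have hnd := hc.1
    -- The items of the other colours come before or after all items of colour `c`.
    rw [hl, List.nodup_append] at hnd
    have hcol : ∀ l : List (Fin m), c ∉ l → ∀ e ∈ (l.flatMap P).flatten,
        decide (I.colour e = c) = false := by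
      intro l hcl e he
      rw [flatten_flatMap, List.mem_flatMap] at he
      obtain ⟨d, hd, hed⟩ := he
      rw [(hpack d).1.2, ColouredInstance.mem_ofColour] at hed
      exact decide_eq_false fun h => hcl (by rwa [← h, hed])
    have hrun := hσ
    rw [hl, List.flatMap_append, List.flatMap_cons, List.flatten_append, List.flatten_append,
      ← List.append_assoc] at hrun
    have h1 := hrun.countP_any_le hs0 hs1 (fun e => decide (I.colour e = c))
      (hcol l₁ fun h => hnd.2.2 c h c (by simp) rfl) (hcol l₂ (List.nodup_cons.1 hnd.2.1).1)
      (hpack c).2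
    have h2 := (hP c).length_le hs0 hs1 hε
    have h3 : (span I (σ.closed ++ σ.opened) c : ℝ) ≤ (P c).length + 2 := by exact_mod_cast h1
    linarith
  · have h1 := hσ.length_bins_le hs0 hs1
    have h2 := weight_le_OPT hs0 (fun e _ => hs1 e) hen
    have h3 : (1.7 : ℝ) = 17 / 10 := by norm_num
    rw [h3]
    exact h1.trans (by linarith)

/-! ### Values of the timed procedures -/

namespace Timed

variable {α β : Type}

@[simp] lemma bind_val (x : Timed α) (f : α → Timed β) : (x >>= f).val = (f x.val).val := rfl

@[simp] lemma bind_steps (x : Timed α) (f : α → Timed β) :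
    (x >>= f).steps = x.steps + (f x.val).steps := rfl

@[simp] lemma pure_val (a : α) : (pure a : Timed α).val = a := rfl

@[simp] lemma pure_steps (a : α) : (pure a : Timed α).steps = 0 := rfl

@[simp] lemma tick_steps : tick.steps = 1 := rfl

end Timed

section values

variable {α β : Type}

@[simp] lemma lengthT_val (l : List α) : (lengthT l).val = l.length := by
  induction l with
  | nil => rfl
  | cons a l ih => simp [lengthT, ih]

@[simp] lemma appendT_val (l l' : List α) : (appendT l l').val = l ++ l' := by
  induction l with
  | nil => rfl
  | cons a l ih => simp [appendT, ih]

@[simp] lemma flattenT_val (l : List (List α)) : (flattenT l).val = l.flatten := by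
  induction l with
  | nil => rfl
  | cons a l ih => simp [flattenT, ih]

@[simp] lemma filterT_val (p : α → Timed Bool) (l : List α) :
    (filterT p l).val = l.filter fun a => (p a).val := by
  induction l with
  | nil => rfl
  | cons a l ih => simp [filterT, ih, List.filter_cons]

@[simp] lemma mapT_val (f : α → Timed β) (l : List α) :
    (mapT f l).val = l.map fun a => (f a).val := by
  induction l with
  | nil => rfl
  | cons a l ih => simp [mapT, ih]

@[simp] lemma flatMapT_val (f : α → Timed (List β)) (l : List α) :
    (flatMapT f l).val = l.flatMap fun a => (f a).val := by
  induction l with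
  | nil => rfl
  | cons a l ih => simp [flatMapT, ih]

@[simp] lemma foldlT_val (f : β → α → Timed β) (b : β) (l : List α) :
    (foldlT f b l).val = l.foldl (fun b a => (f b a).val) b := by
  induction l generalizing b with
  | nil => rfl
  | cons a l ih => simp [foldlT, ih]

@[simp] lemma splitT_val (q : ℕ) (l : List α) : (splitT q l).val = (l.take q, l.drop q) := by
  induction q generalizing l with
  | zero => simp [splitT]
  | succ q ih =>
    cases l with
    | nil => simp [splitT]
    | cons a l => simp [splitT, ih]

lemma mem_downT {a b : ℕ} : a ∈ (downT b).val ↔ a ≤ b := by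
  induction b with
  | zero => simp [downT]
  | succ b ih =>
    simp [downT, ih]
    omega

lemma mem_vectorsT {t b : ℕ} {v : List ℕ} :
    v ∈ (vectorsT t b).val ↔ v.length = t ∧ v.sum ≤ b := by
  induction t generalizing b v with
  | zero =>
    simp only [vectorsT, Timed.bind_val, Timed.pure_val, List.mem_singleton,
      List.length_eq_zero_iff]
    constructor
    · rintro rfl
      simp
    · exact fun h => h.1
  | succ t ih =>
    simp only [vectorsT, Timed.bind_val, Timed.pure_val, flatMapT_val, mapT_val, List.mem_flatMap,
      List.mem_map, mem_downT, ih]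
    constructor
    · rintro ⟨a, ha, w, ⟨hw, hws⟩, rfl⟩
      simp only [List.length_cons, List.sum_cons]
      omega
    · rintro ⟨hl, hs⟩
      match v, hl, hs with
      | a :: w, hl, hs =>
        simp only [List.length_cons, List.sum_cons] at hl hs
        exact ⟨a, by omega, w, ⟨by omega, by omega⟩, rfl⟩

@[simp] lemma sumT_val (v : List ℕ) : (sumT v).val = v.sum := by
  induction v with
  | nil => rfl
  | cons a v ih => simp [sumT, ih]

@[simp] lemma addMulT_val (a : ℕ) (v w : List ℕ) :
    (addMulT a v w).val = List.zipWith (fun x y => a * x + y) v w := by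
  induction v generalizing w with
  | nil => cases w <;> rfl
  | cons x v ih =>
    cases w with
    | nil => rfl
    | cons y w => simp [addMulT, ih]

@[simp] lemma eqT_val (v w : List ℕ) : (eqT v w).val = decide (v = w) := by
  induction v generalizing w with
  | nil => cases w <;> simp [eqT]
  | cons x v ih =>
    cases w with
    | nil => simp [eqT]
    | cons y w =>
      simp only [eqT, Timed.bind_val, Timed.pure_val, ih, List.cons.injEq, Bool.decide_and]
      rfl

lemma minSumT_spec (vs : List (List ℕ)) :
    ((minSumT vs).val = none ∧ vs = []) ∨
      ∃ w ∈ vs, (minSumT vs).val = some w ∧ ∀ v ∈ vs, w.sum ≤ v.sum := by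
  induction vs with
  | nil => exact .inl ⟨rfl, rfl⟩
  | cons v vs ih =>
    right
    rcases ih with ⟨h, rfl⟩ | ⟨w, hw, h, hmin⟩
    · exact ⟨v, by simp, by simp [minSumT], by simp⟩
    · by_cases hvw : v.sum ≤ w.sum
      · refine ⟨v, by simp, by simp [minSumT, h, hvw], ?_⟩
        simp only [List.mem_cons, forall_eq_or_imp, le_refl, true_and]
        exact fun u hu => hvw.trans (hmin u hu)
      · refine ⟨w, by simp [hw], by simp [minSumT, h, hvw], ?_⟩
        simp only [List.mem_cons, forall_eq_or_imp]
        exact ⟨by omega, hmin⟩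

@[simp] lemma loadT_val (s : ι → ℝ) (B : List ι) : (loadT s B).val = load s B := by
  induction B with
  | nil => rfl
  | cons e B ih => simp [loadT, ih]

lemma insertT_perm (s : ι → ℝ) (e : ι) (l : List ι) : (insertT s e l).val.Perm (e :: l) := by
  induction l with
  | nil => simp [insertT]
  | cons f l ih =>
    simp only [insertT, Timed.bind_val]
    split_ifs
    · simp
    · simp only [Timed.bind_val, Timed.pure_val]
      exact (ih.cons f).trans (List.Perm.swap _ _ _)

lemma insertT_pairwise {s : ι → ℝ} {e : ι} {l : List ι} (hl : l.Pairwise fun e f => s e ≤ s f) :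
    (insertT s e l).val.Pairwise fun e f => s e ≤ s f := by
  induction l with
  | nil => simp [insertT]
  | cons f l ih =>
    simp only [insertT, Timed.bind_val]
    rw [List.pairwise_cons] at hl
    split_ifs with h
    · simp only [Timed.pure_val, List.pairwise_cons, List.mem_cons, forall_eq_or_imp]
      exact ⟨⟨h, fun g hg => h.trans (hl.1 g hg)⟩, hl⟩
    · simp only [Timed.bind_val, Timed.pure_val, List.pairwise_cons]
      refine ⟨fun g hg => ?_, ih hl.2⟩
      rcases List.mem_cons.1 ((insertT_perm s e l).mem_iff.1 hg) with rfl | hg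
      · exact (not_le.1 h).le
      · exact hl.1 g hg

lemma sortT_perm (s : ι → ℝ) (l : List ι) : (sortT s l).val.Perm l := by
  induction l with
  | nil => simp [sortT]
  | cons e l ih => exact (insertT_perm s e _).trans (ih.cons e)

lemma sortT_pairwise (s : ι → ℝ) (l : List ι) : (sortT s l).val.Pairwise fun e f => s e ≤ s f := by
  induction l with
  | nil => simp [sortT]
  | cons e l ih => exact insertT_pairwise ih

@[simp] lemma groupsT_val (q K : ℕ) (L : List ι) : (groupsT q K L).val = groups q K L := by
  induction K generalizing L with
  | zero => rfl
  | succ K ih => simp [groupsT, groups, ih]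

lemma length_groups (q K : ℕ) (L : List ι) : (groups q K L).length = K := by
  induction K generalizing L with
  | zero => rfl
  | succ K ih => simp [groups, ih]

lemma maxSizeT_nonneg (s : ι → ℝ) (g : List ι) : 0 ≤ (maxSizeT s g).val := by
  induction g with
  | nil => simp [maxSizeT]
  | cons e g ih => exact ih.trans (le_max_right _ _)

lemma le_maxSizeT (s : ι → ℝ) {g : List ι} {e : ι} (he : e ∈ g) : s e ≤ (maxSizeT s g).val := by
  induction g with
  | nil => simp at he
  | cons f g ih =>
    rcases List.mem_cons.1 he with rfl | he
    · exact le_max_left _ _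
    · exact (ih he).trans (le_max_right _ _)

lemma maxSizeT_mem {s : ι → ℝ} (hs : ∀ e, 0 ≤ s e) {g : List ι} (hg : g ≠ []) :
    ∃ e ∈ g, s e = (maxSizeT s g).val := by
  induction g with
  | nil => simp at hg
  | cons f g ih =>
    have h : (maxSizeT s (f :: g)).val = max (s f) (maxSizeT s g).val := rfl
    rcases max_choice (s f) (maxSizeT s g).val with h1 | h1
    · exact ⟨f, by simp, by rw [h, h1]⟩
    · rcases eq_or_ne g [] with rfl | hg'
      · refine ⟨f, by simp, ?_⟩
        rw [h]
        exact (max_eq_left (hs f)).symm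
      · obtain ⟨e, he, he'⟩ := ih hg'
        exact ⟨e, by simp [he], by rw [h, h1, he']⟩

@[simp] lemma firstFitItemT_val (s : ι → ℝ) (e : ι) (P : List (List ι)) :
    (firstFitItemT s e P).val = firstFitItem s e P := by
  induction P with
  | nil => rfl
  | cons B P ih =>
    simp only [firstFitItemT, firstFitItem, Timed.bind_val, loadT_val]
    split_ifs <;> simp [ih]

lemma fullestT_spec (s : ι → ℝ) (cap : ℝ) (l : List (List ι)) :
    ((fullestT s cap l).val = none ∧ ∀ B ∈ l, cap < load s B) ∨
      ∃ B rest, (fullestT s cap l).val = some (B, rest) ∧ l.Perm (B :: rest) ∧ load s B ≤ cap ∧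
        ∀ B' ∈ l, load s B' ≤ cap → load s B' ≤ load s B := by
  induction l with
  | nil => exact .inl ⟨rfl, by simp⟩
  | cons B l ih =>
    rcases ih with ⟨h, hall⟩ | ⟨C, rest, h, hp, hC, hmax⟩
    · by_cases hB : load s B ≤ cap
      · refine .inr ⟨B, l, by simp [fullestT, h, hB], .refl _, hB, ?_⟩
        simp only [List.mem_cons, forall_eq_or_imp, le_refl, implies_true, true_and]
        exact fun B' hB' h' => absurd (hall B' hB') (not_lt.2 h')
      · refine .inl ⟨by simp [fullestT, h, hB], ?_⟩
        simp only [List.mem_cons, forall_eq_or_imp]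
        exact ⟨not_le.1 hB, hall⟩
    · right
      by_cases hB : load s B ≤ cap ∧ load s C ≤ load s B
      · refine ⟨B, l, by simp [fullestT, h, hB], .refl _, hB.1, ?_⟩
        simp only [List.mem_cons, forall_eq_or_imp, le_refl, implies_true, true_and]
        exact fun B' hB' h' => (hmax B' hB' h').trans hB.2
      · refine ⟨C, B :: rest, by simp [fullestT, h, hB], (hp.cons B).trans (.swap _ _ _), hC, ?_⟩
        simp only [List.mem_cons, forall_eq_or_imp]
        refine ⟨fun h' => ?_, hmax⟩
        by_contra h''
        exact hB ⟨h', (not_le.1 h'').le⟩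

lemma bbfStepT_step {s : ι → ℝ} {k : ℕ} (hk : 0 < k) {σ : BBFState ι} {l : List ι}
    (hσ : σ.Packs s k l) (e : ι) : BBFStep s k σ e (bbfStepT s k σ e).val := by
  obtain ⟨cl, op⟩ := σ
  rcases fullestT_spec s (1 - s e) op with ⟨h, hall⟩ | ⟨B, rest, h, hp, hB, hmax⟩
  · have hno : ∀ B' ∈ op, 1 < load s B' + s e := fun B' hB' => by linarith [hall B' hB']
    by_cases hlt : op.length < k
    · have : (bbfStepT s k ⟨cl, op⟩ e).val = ⟨cl, [e] :: op⟩ := by simp [bbfStepT, h, hlt]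
      rw [this]
      exact .new _ _ _ hno hlt
    · have hlen : op.length = k := le_antisymm hσ.opened_le (not_lt.1 hlt)
      have hle : ∀ B ∈ op, load s B ≤ 1 := fun B hB => hσ.load_le B (by simp [BBFState.bins, hB])
      rcases fullestT_spec s 1 op with ⟨-, hall'⟩ | ⟨B, rest, h', hp, hB, hmax⟩
      · obtain ⟨B, hB⟩ := List.exists_mem_of_length_pos (hlen.symm ▸ hk)
        exact absurd (hall' B hB) (not_lt.2 (hle B hB))
      · have : (bbfStepT s k ⟨cl, op⟩ e).val = ⟨B :: cl, [e] :: rest⟩ := by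
          simp [bbfStepT, h, hlt, h']
        rw [this]
        exact .close _ _ _ _ _ hno hlen hp fun B' hB' => hmax B' hB' (hle B' hB')
  · have : (bbfStepT s k ⟨cl, op⟩ e).val = ⟨cl, (B ++ [e]) :: rest⟩ := by simp [bbfStepT, h]
    rw [this]
    exact .fit _ _ _ _ _ hp (by linarith) fun B' hB' h' => hmax B' hB' (by linarith)

lemma foldlT_bbfStepT_run {s : ι → ℝ} (hs : ∀ e, s e ≤ 1) {k : ℕ} (hk : 0 < k) (l : List ι) :
    BBFRun s k ⟨[], []⟩ l (foldlT (bbfStepT s k) ⟨[], []⟩ l).val := by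
  have key : ∀ (l l' : List ι) (σ : BBFState ι), σ.Packs s k l' →
      BBFRun s k σ l (foldlT (bbfStepT s k) σ l).val := by
    intro l
    induction l with
    | nil => exact fun l' σ _ => .nil σ
    | cons e l ih =>
      intro l' σ hσ
      have hst := bbfStepT_step hk hσ e
      exact .cons _ _ _ _ _ hst (ih _ _ (hσ.step hs hst))
  exact key l [] _ ⟨by simp [BBFState.bins], by simp [BBFState.bins], by simp⟩

end values

/-! ### Packings described by bin types -/

lemma zipWith_zero_mul_add {v w : List ℕ} (h : v.length = w.length) :
    List.zipWith (fun x y => 0 * x + y) v w = w := by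
  induction v generalizing w with
  | nil => simpa [eq_comm] using h
  | cons x v ih =>
    cases w with
    | nil => simp
    | cons y w => simpa using ih (by simpa using h)

lemma length_combineT {K : ℕ} {z : List ℕ} (hz : z.length = K) (as : List ℕ) {τs : List (List ℕ)}
    (hτ : ∀ τ ∈ τs, τ.length = K) : (combineT z as τs).val.length = K := by
  induction as generalizing τs with
  | nil => simpa [combineT] using hz
  | cons a as ih =>
    cases τs with
    | nil => simpa [combineT] using hz
    | cons τ τs =>
      have h1 := ih fun σ hσ => hτ σ (List.mem_cons_of_mem _ hσ)
      have h2 := hτ τ (by simp)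
      simp only [combineT, Timed.bind_val, addMulT_val, List.length_zipWith, h1, h2, min_self]

/-- A further bin of one of the types can be added to a combination of bin types. -/
lemma exists_combineT_add (z : List ℕ) {τs : List (List ℕ)} {τ : List ℕ} (hτ : τ ∈ τs)
    {v : List ℕ} (hv : v.length = τs.length) :
    ∃ v' : List ℕ, v'.length = τs.length ∧ v'.sum = v.sum + 1 ∧
      (combineT z v' τs).val = List.zipWith (· + ·) τ (combineT z v τs).val := by
  induction τs generalizing v with
  | nil => simp at hτ
  | cons σ τs ih =>
    match v, hv with
    | a :: v, hav =>
      have hlen : v.length = τs.length := by simpa using hav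
      rcases List.mem_cons.1 hτ with rfl | hτ
      · refine ⟨(a + 1) :: v, by simp [hlen], by simp only [List.sum_cons]; omega, ?_⟩
        simp only [combineT, Timed.bind_val, addMulT_val]
        apply List.ext_getElem
        · simp
        · intro i h1 h2
          simp only [List.getElem_zipWith]
          ring
      · obtain ⟨v', h1, h2, h3⟩ := ih hτ hlen
        refine ⟨a :: v', by simp [h1], by simp only [List.sum_cons]; omega, ?_⟩
        simp only [combineT, Timed.bind_val, addMulT_val, h3]
        apply List.ext_getElem
        · simp only [List.length_zipWith]
          omega
        · intro i h1 h2
          simp only [List.getElem_zipWith]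
          ring

/-- The type of a bin: how many of its items lie in each group. -/
def binType [DecidableEq ι] (gs : List (List ι)) (B : List ι) : List ℕ :=
  gs.map fun g => B.countP (· ∈ g)

lemma combineT_replicate_zero {z : List ℕ} {τs : List (List ℕ)}
    (hτ : ∀ τ ∈ τs, τ.length = z.length) :
    (combineT z (List.replicate τs.length 0) τs).val = z := by
  induction τs with
  | nil => rfl
  | cons τ τs ih =>
    simp only [List.length_cons, List.replicate_succ, combineT, Timed.bind_val, addMulT_val]
    rw [ih fun σ hσ => hτ σ (by simp [hσ]), zipWith_zero_mul_add (hτ τ (by simp))]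

/-- Every packing is described by some numbers of bins of each type. -/
lemma exists_combineT_eq [DecidableEq ι] {gs : List (List ι)} {τs : List (List ℕ)}
    (hτ : ∀ τ ∈ τs, τ.length = gs.length) {P : List (List ι)} (hP : ∀ B ∈ P, binType gs B ∈ τs) :
    ∃ v : List ℕ, v.length = τs.length ∧ v.sum = P.length ∧
      (combineT (gs.map fun _ => 0) v τs).val = binType gs P.flatten := by
  induction P with
  | nil =>
    refine ⟨List.replicate τs.length 0, by simp, by simp, ?_⟩
    rw [combineT_replicate_zero (by simpa using hτ)]
    simp [binType]
  | cons B P ih =>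
    obtain ⟨v, h1, h2, h3⟩ := ih fun C hC => hP C (by simp [hC])
    obtain ⟨v', h4, h5, h6⟩ := exists_combineT_add (gs.map fun _ => 0) (hP B (by simp)) h1
    refine ⟨v', h4, by simp [h5, h2], ?_⟩
    rw [h6, h3]
    simp only [binType, List.flatten_cons, List.countP_append]
    rw [List.zipWith_map, List.zipWith_self]

lemma load_filter_or {s : ι → ℝ} (p q : ι → Bool) (B : List ι)
    (h : ∀ e ∈ B, ¬(p e = true ∧ q e = true)) :
    load s (B.filter fun e => p e || q e) = load s (B.filter p) + load s (B.filter q) := by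
  induction B with
  | nil => simp
  | cons e B ih =>
    have h1 := ih fun f hf => h f (by simp [hf])
    have h2 := h e (by simp)
    simp only [List.filter_cons]
    cases hp : p e <;> cases hq : q e <;> simp_all <;> ring

lemma load_eq_of_const {r : ι → ℝ} {x : ℝ} {B : List ι} (h : ∀ e ∈ B, r e = x) :
    load r B = B.length * x := by
  induction B with
  | nil => simp
  | cons e B ih =>
    rw [load_cons, ih fun f hf => h f (by simp [hf]), h e (by simp), List.length_cons]
    push_cast
    ring

/-- The load of a bin with rounded sizes can be read off its type. -/
lemma dotT_binType [DecidableEq ι] {r : ι → ℝ} {gs : List (List ι)} (hnd : gs.flatten.Nodup)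
    {size : List ι → ℝ} (hr : ∀ g ∈ gs, ∀ e ∈ g, r e = size g) (B : List ι) :
    (dotT (binType gs B) (gs.map size)).val = load r (B.filter (· ∈ gs.flatten)) := by
  induction gs with
  | nil => simp [binType, dotT]
  | cons g gs ih =>
    rw [List.flatten_cons, List.nodup_append] at hnd
    have h1 := ih hnd.2.1 fun g' hg' => hr g' (by simp [hg'])
    have h2 := load_filter_or (s := r) (fun e => decide (e ∈ g))
      (fun e => decide (e ∈ gs.flatten)) B
      (fun e _ h => by
        simp only [decide_eq_true_eq] at h
        exact hnd.2.2 e h.1 e h.2 rfl)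
    have h3 : load r (B.filter (· ∈ g)) = B.countP (· ∈ g) * size g := by
      rw [load_eq_of_const (x := size g), List.countP_eq_length_filter]
      intro e he
      exact hr g (by simp) e (by simpa using (List.mem_filter.1 he).2)
    rw [binType] at h1
    simp only [binType, List.map_cons, dotT, Timed.bind_val, Timed.pure_val, List.flatten_cons,
      List.mem_append, Bool.decide_or]
    rw [h2, h3, h1]

lemma sum_binType [DecidableEq ι] {gs : List (List ι)} (hnd : gs.flatten.Nodup) (B : List ι) :
    (binType gs B).sum ≤ B.length := by
  have h := dotT_binType hnd (r := fun _ => 1) (size := fun _ => 1) (fun _ _ _ _ => rfl) B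
  rw [load_eq_of_const (x := 1) (fun _ _ => rfl), mul_one] at h
  have h1 : ∀ gs : List (List ι), (dotT (binType gs B) (gs.map fun _ => 1)).val
      = ((binType gs B).sum : ℝ) := by
    intro gs
    induction gs with
    | nil => simp [binType, dotT]
    | cons g gs ih =>
      simp only [binType] at ih
      simp only [binType, List.map_cons, dotT, Timed.bind_val, Timed.pure_val, ih, List.sum_cons,
        mul_one, Nat.cast_add]
  rw [h1] at h
  have h2 : (binType gs B).sum = (B.filter (· ∈ gs.flatten)).length := by exact_mod_cast h
  rw [h2]
  exact List.length_filter_le _ _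

lemma binType_eq_of_perm [DecidableEq ι] {gs : List (List ι)} (hnd : gs.flatten.Nodup)
    {B : List ι} (hB : B.Perm gs.flatten) : binType gs B = gs.map List.length := by
  refine List.map_congr_left fun g hg => ?_
  rw [List.countP_eq_length_filter]
  apply List.Perm.length_eq
  rw [List.perm_ext_iff_of_nodup ((hB.nodup_iff.2 hnd).filter _)
    (hnd.sublist (List.sublist_flatten_of_mem hg))]
  intro e
  simp only [List.mem_filter, decide_eq_true_eq, and_iff_right_iff_imp, hB.mem_iff]
  exact fun he => List.mem_flatten.2 ⟨g, hg, he⟩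

/-! ### Filling bins of given types -/

lemma fillBinT_perm (τ : List ℕ) (gs : List (List ι)) :
    ((fillBinT τ gs).val.1 ++ (fillBinT τ gs).val.2.flatten).Perm gs.flatten := by
  induction τ generalizing gs with
  | nil => simp [fillBinT]
  | cons a τ ih =>
    cases gs with
    | nil => simp [fillBinT]
    | cons g gs =>
      simp only [fillBinT, Timed.bind_val, Timed.pure_val, splitT_val, appendT_val,
        List.flatten_cons, List.append_assoc]
      refine (((List.perm_append_comm_assoc _ _ _).trans
        ((ih gs).append_left (g.drop a))).append_left (g.take a)).trans ?_
      rw [← List.append_assoc, List.take_append_drop]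

/-- The items in each group have at most the given size. The sizes are nonnegative, which matters
for empty groups. -/
def SizesBound (r : ι → ℝ) (gs : List (List ι)) (sizes : List ℝ) : Prop :=
  List.Forall₂ (fun g x => 0 ≤ x ∧ ∀ e ∈ g, r e ≤ x) gs sizes

lemma load_le_mul {r : ι → ℝ} {x : ℝ} {B : List ι} (h : ∀ e ∈ B, r e ≤ x) :
    load r B ≤ B.length * x := by
  induction B with
  | nil => simp
  | cons e B ih =>
    have := ih fun f hf => h f (by simp [hf])
    have := h e (by simp)
    simp only [load_cons, List.length_cons]
    push_cast
    linarith

/-- A filled bin holds at most as many items of each group as its type says, whether or not the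
groups have enough items left. -/
lemma fillBinT_load {r : ι → ℝ} (τ : List ℕ) {gs : List (List ι)} {sizes : List ℝ}
    (h : SizesBound r gs sizes) :
    load r (fillBinT τ gs).val.1 ≤ (dotT τ sizes).val ∧
      SizesBound r (fillBinT τ gs).val.2 sizes := by
  induction τ generalizing gs sizes with
  | nil => exact ⟨by simp [fillBinT, dotT], by simpa [fillBinT] using h⟩
  | cons a τ ih =>
    cases h with
    | nil => exact ⟨by simp [fillBinT, dotT], by simpa [fillBinT] using .nil⟩
    | @cons g x gs sizes hg h =>
      obtain ⟨h1, h2⟩ := ih h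
      simp only [fillBinT, dotT, Timed.bind_val, Timed.pure_val, splitT_val, appendT_val,
        load_append]
      refine ⟨add_le_add ?_ h1, .cons ⟨hg.1, fun e he => hg.2 e (List.mem_of_mem_drop he)⟩ h2⟩
      refine (load_le_mul fun e he => hg.2 e (List.mem_of_mem_take he)).trans ?_
      refine mul_le_mul_of_nonneg_right ?_ hg.1
      exact_mod_cast List.length_take_le a g

lemma fillBinT_length (τ : List ℕ) {gs : List (List ι)} {R : List ℕ} {a : ℕ}
    (hτ : τ.length = R.length)
    (h : gs.map List.length = List.zipWith (fun x y => (a + 1) * x + y) τ R) :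
    (fillBinT τ gs).val.2.map List.length = List.zipWith (fun x y => a * x + y) τ R := by
  induction τ generalizing gs R with
  | nil => simpa [fillBinT] using h
  | cons b τ ih =>
    match R, hτ, gs, h with
    | c :: R, hτ, g :: gs, h =>
      simp only [List.map_cons, List.zipWith_cons_cons, List.cons.injEq] at h
      have h1 := ih (by simpa using hτ) h.2
      simp only [fillBinT, Timed.bind_val, Timed.pure_val, splitT_val, List.map_cons,
        List.zipWith_cons_cons, List.length_drop, List.cons.injEq]
      refine ⟨?_, h1⟩
      rw [h.1, add_mul, one_mul]
      omega

lemma fillCopiesT_spec {r : ι → ℝ} {τ : List ℕ} {sizes : List ℝ} {R : List ℕ}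
    (hτ1 : (dotT τ sizes).val ≤ 1) (hτ : τ.length = R.length) (a : ℕ) {gs : List (List ι)}
    (hgs : SizesBound r gs sizes)
    (h : gs.map List.length = List.zipWith (fun x y => a * x + y) τ R) :
    ((fillCopiesT τ a gs).val.1.flatten ++ (fillCopiesT τ a gs).val.2.flatten).Perm gs.flatten ∧
      (∀ B ∈ (fillCopiesT τ a gs).val.1, load r B ≤ 1) ∧
      (fillCopiesT τ a gs).val.1.length = a ∧
      SizesBound r (fillCopiesT τ a gs).val.2 sizes ∧
      (fillCopiesT τ a gs).val.2.map List.length = R := by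
  induction a generalizing gs with
  | zero =>
    rw [zipWith_zero_mul_add hτ] at h
    exact ⟨by simp [fillCopiesT], by simp [fillCopiesT], by simp [fillCopiesT],
      by simpa [fillCopiesT] using hgs, by simpa [fillCopiesT] using h⟩
  | succ a ih =>
    obtain ⟨h1, h2⟩ := fillBinT_load τ hgs
    obtain ⟨i1, i2, i3, i4, i5⟩ := ih h2 (fillBinT_length τ hτ h)
    simp only [fillCopiesT, Timed.bind_val, Timed.pure_val]
    refine ⟨?_, ?_, by simp [i3], i4, i5⟩
    · rw [List.flatten_cons, List.append_assoc]
      exact (i1.append_left _).trans (fillBinT_perm τ gs)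
    · simp only [List.mem_cons, forall_eq_or_imp]
      exact ⟨h1.trans hτ1, i2⟩

/-- If the bin types with their multiplicities `as` match the sizes of the groups, then filling the
bins packs all items. -/
lemma fillT_spec {r : ι → ℝ} {sizes : List ℝ} {K : ℕ} {as : List ℕ} {τs : List (List ℕ)}
    (hlen : as.length = τs.length) (hτ1 : ∀ τ ∈ τs, (dotT τ sizes).val ≤ 1)
    (hτ : ∀ τ ∈ τs, τ.length = K) {gs : List (List ι)} (hgs : SizesBound r gs sizes)
    {z : List ℕ} (hz : z.length = K) (hz0 : ∀ x ∈ z, x = 0)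
    (h : gs.map List.length = (combineT z as τs).val) :
    (fillT as τs gs).val.flatten.Perm gs.flatten ∧ (∀ B ∈ (fillT as τs gs).val, load r B ≤ 1) ∧
      (fillT as τs gs).val.length = as.sum := by
  induction as generalizing τs gs with
  | nil =>
    have h0 : gs.flatten = [] := by
      rw [List.flatten_eq_nil_iff]
      intro g hg
      apply List.eq_nil_of_length_eq_zero
      apply hz0
      have : (combineT z [] τs).val = z := by simp [combineT]
      rw [← this, ← h]
      exact List.mem_map_of_mem hg
    simp [fillT, h0]
  | cons a as ih =>
    match τs, hlen with
    | τ :: τs, hlen =>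
      have hτ' : ∀ σ ∈ τs, σ.length = K := fun σ hσ => hτ σ (by simp [hσ])
      simp only [combineT, Timed.bind_val, addMulT_val] at h
      obtain ⟨i1, i2, i3, i4, i5⟩ := fillCopiesT_spec (hτ1 τ (by simp))
        ((hτ τ (by simp)).trans (length_combineT hz as hτ').symm) a hgs h
      obtain ⟨j1, j2, j3⟩ := ih (by simpa using hlen) (fun σ hσ => hτ1 σ (by simp [hσ])) hτ' i4 i5
      simp only [fillT, Timed.bind_val, appendT_val]
      refine ⟨?_, ?_, by simp [i3, j3]⟩
      · rw [List.flatten_append]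
        exact (j1.append_left _).trans i1
      · intro B hB
        rcases List.mem_append.1 hB with hB | hB
        · exact i2 B hB
        · exact j2 B hB

lemma exists_eq_on_groups {gs : List (List ι)} (hnd : gs.flatten.Nodup) (size : List ι → ℝ) :
    ∃ r : ι → ℝ, ∀ g ∈ gs, ∀ e ∈ g, r e = size g := by
  classical
  induction gs with
  | nil => simp
  | cons g gs ih =>
    rw [List.flatten_cons, List.nodup_append] at hnd
    obtain ⟨r, hr⟩ := ih hnd.2.1
    refine ⟨fun e => if e ∈ g then size g else r e, fun g' hg' e he => ?_⟩
    rcases List.mem_cons.1 hg' with rfl | hg'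
    · exact if_pos he
    · exact (if_neg fun h => hnd.2.2 e h e (List.mem_flatten.2 ⟨g', hg', he⟩) rfl).trans
        (hr g' hg' e he)

/-- The enumeration of bin types and packings finds an optimal packing of the rounded items. -/
lemma packLargeT_spec {s : ι → ℝ} {ε : ℝ} (hε : 0 < ε) (hs0 : ∀ e, 0 ≤ s e) (hs1 : ∀ e, s e ≤ 1)
    {L : List ι} (hL : L.Nodup) (hLε : ∀ e ∈ L, ε ≤ s e) :
    ∃ r : ι → ℝ, (∀ g ∈ groups ⌈(L.length : ℝ) * ε ^ 2⌉₊ ⌈1 / ε ^ 2⌉₊ L, ∀ e ∈ g,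
        IsGreatest (s '' {x | x ∈ g}) (r e)) ∧
      (packLargeT s ε L).val.flatten.Perm L ∧ (∀ B ∈ (packLargeT s ε L).val, load r B ≤ 1) ∧
      ∀ P : List (List ι), P.flatten.Perm L → (∀ B ∈ P, load r B ≤ 1) →
        (packLargeT s ε L).val.length ≤ P.length := by
  classical
  set K := ⌈1 / ε ^ 2⌉₊ with hK
  set gs := groups ⌈(L.length : ℝ) * ε ^ 2⌉₊ K L with hgs
  have hflat : gs.flatten = L := groups_flatten_eq hε L
  have hnd : gs.flatten.Nodup := hflat ▸ hL
  have hgsK : gs.length = K := length_groups _ _ _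
  set size : List ι → ℝ := fun g => (maxSizeT s g).val with hsize
  obtain ⟨r, hr⟩ : ∃ r : ι → ℝ, ∀ g ∈ gs, ∀ e ∈ g, r e = size g :=
    exists_eq_on_groups hnd size
  have hgreat : ∀ g ∈ gs, ∀ e ∈ g, IsGreatest (s '' {x | x ∈ g}) (r e) := by
    intro g hg e he
    rw [hr g hg e he]
    obtain ⟨x, hx, hxs⟩ := maxSizeT_mem hs0 (List.ne_nil_of_mem he)
    refine ⟨⟨x, hx, hxs⟩, ?_⟩
    rintro _ ⟨y, hy, rfl⟩
    exact le_maxSizeT s hy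
  have hrb : ∀ e ∈ L, s e ≤ r e ∧ r e ≤ 1 := fun e he => rounded_bounds hs1 hε hgreat he
  set types := (vectorsT K ⌊1 / ε⌋₊).val.filter
    fun τ => decide ((dotT τ (gs.map size)).val ≤ 1) with htypes
  set packings := (vectorsT types.length L.length).val.filter
    fun v => decide ((combineT (gs.map fun _ => 0) v types).val = gs.map List.length) with hpackings
  have hval : (packLargeT s ε L).val
      = (fillT ((minSumT packings).val.getD []) types gs).val := by
    simp only [packLargeT, Timed.bind_val, Timed.pure_val, lengthT_val, groupsT_val, mapT_val,
      filterT_val, eqT_val]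
    rfl
  have htype : ∀ τ ∈ types, τ.length = K ∧ (dotT τ (gs.map size)).val ≤ 1 := by
    intro τ hτ
    obtain ⟨h1, h2⟩ := List.mem_filter.1 hτ
    exact ⟨(mem_vectorsT.1 h1).1, by simpa using h2⟩
  -- A packing without empty bins is one of the enumerated packings.
  have hcand : ∀ P : List (List ι), P.flatten.Perm L → (∀ B ∈ P, load r B ≤ 1) →
      ∃ v ∈ packings, v.sum ≤ P.length := by
    intro P₀ hP₀ hP₀1
    set P := P₀.filter fun B => !B.isEmpty with hPdef
    have hPf : P.flatten = P₀.flatten := List.flatten_filter_not_isEmpty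
    have hP : P.flatten.Perm L := by rwa [hPf]
    have hP1 : ∀ B ∈ P, load r B ≤ 1 := fun B hB => hP₀1 B (List.mem_of_mem_filter hB)
    have hbin : ∀ B ∈ P, binType gs B ∈ types := by
      intro B hB
      have hBL : ∀ e ∈ B, e ∈ L := fun e he => hP.mem_iff.1 (List.mem_flatten.2 ⟨B, hB, he⟩)
      rw [htypes, List.mem_filter, mem_vectorsT, decide_eq_true_eq]
      refine ⟨⟨by simp [binType, hgsK], (sum_binType hnd B).trans (Nat.le_floor ?_)⟩, ?_⟩
      · rw [le_div_iff₀ hε]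
        refine (mul_length_le_load fun e he => ?_).trans (hP1 B hB)
        exact (hLε e (hBL e he)).trans (hrb e (hBL e he)).1
      · rw [dotT_binType hnd hr, List.filter_eq_self.2]
        · exact hP1 B hB
        · intro e he
          rw [hflat]
          exact decide_eq_true (hBL e he)
    obtain ⟨v, h1, h2, h3⟩ := exists_combineT_eq
      (fun τ hτ => ((htype τ hτ).1.trans hgsK.symm)) hbin
    refine ⟨v, ?_, h2.trans_le (List.length_filter_le _ _)⟩
    rw [hpackings, List.mem_filter, mem_vectorsT, decide_eq_true_eq]
    refine ⟨⟨h1, ?_⟩, ?_⟩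
    · rw [h2, ← hP.length_eq, List.length_flatten]
      refine (List.length_map List.length (as := P)).symm.trans_le
        (List.length_le_sum_of_one_le _ fun i hi => ?_)
      obtain ⟨B, hB, rfl⟩ := List.mem_map.1 hi
      have := (List.mem_filter.1 hB).2
      cases B with
      | nil => simp at this
      | cons e B => simp
    · rw [h3]
      exact binType_eq_of_perm hnd (by rwa [hflat])
  rcases minSumT_spec packings with ⟨-, h⟩ | ⟨v, hv, hmin, hle⟩
  · obtain ⟨v, hv, -⟩ := hcand (L.map fun e => [e]) (by rw [flatten_map_singleton])
      (by simpa using fun e he => (hrb e he).2)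
    rw [h] at hv
    simp at hv
  · obtain ⟨h1, h2⟩ := List.mem_filter.1 hv
    rw [decide_eq_true_eq] at h2
    rw [hmin, Option.getD_some] at hval
    have hsb : SizesBound r gs (gs.map size) := by
      rw [SizesBound, List.forall₂_map_right_iff, List.forall₂_same]
      exact fun g hg => ⟨maxSizeT_nonneg s g, fun e he => (hr g hg e he).le⟩
    obtain ⟨i1, i2, i3⟩ := fillT_spec (mem_vectorsT.1 h1).1 (fun τ hτ => (htype τ hτ).2)
      (fun τ hτ => (htype τ hτ).1) hsb (by simp [hgsK]) (by simp) h2.symm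
    rw [hval]
    refine ⟨r, hgreat, by rwa [hflat] at i1, i2, fun P hP hP1 => ?_⟩
    obtain ⟨w, hw, hwP⟩ := hcand P hP hP1
    rw [i3]
    exact (hle w hw).trans hwP

lemma vlT_isVLPacking {s : ι → ℝ} (hs0 : ∀ e, 0 ≤ s e) (hs1 : ∀ e, s e ≤ 1) {ε : ℝ} (hε : 0 < ε)
    {l : List ι} {X : Finset ι} (hl : Enumerates l X) : IsVLPacking s ε X (vlT s ε l).val := by
  set L := (sortT s (l.filter fun e => decide (ε ≤ s e))).val with hLdef
  have hen : ∀ p : ι → Prop, ∀ [DecidablePred p],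
      Enumerates (l.filter fun e => decide (p e)) (X.filter p) := by
    intro p _
    refine ⟨hl.1.filter _, fun e => ?_⟩
    rw [List.mem_filter, Finset.mem_filter, hl.2, decide_eq_true_eq]
  have hL : Enumerates L (X.filter fun e => ε ≤ s e) := (hen _).of_perm (sortT_perm s _)
  obtain ⟨r, h1, h2, h3, h4⟩ := packLargeT_spec hε hs0 hs1 hL.1
    (fun e he => (Finset.mem_filter.1 ((hL.2 e).1 he)).2)
  refine ⟨L, l.filter fun e => decide (s e < ε), r, (packLargeT s ε L).val, hL, sortT_pairwise s _,
    hen _, h1, ⟨hL.of_perm h2, h3⟩, fun Q' hQ' => h4 Q' (hQ'.1.perm hL) hQ'.2, ?_⟩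
  simp only [vlT, Timed.bind_val, Timed.pure_val, filterT_val, foldlT_val, firstFitItemT_val]
  rfl

lemma algorithmT_isOutput {ε : ℝ} (hε : 0 < ε) {n m : ℕ} (I : ColouredInstance n m) :
    IsOutput ε n m I (algorithmT ε I).val := by
  have hs0 : ∀ e, 0 ≤ I.size e := fun e => (I.size_pos e).le
  set X : Fin m → List (Fin n) := fun c => (List.finRange n).filter fun e =>
    decide (I.colour e = c) with hX
  refine ⟨List.finRange m, fun c => (vlT I.size ε (X c)).val,
    (foldlT (bbfStepT I.size 2) ⟨[], []⟩
      ((List.finRange m).flatMap fun c => (vlT I.size ε (X c)).val).flatten).val,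
    ⟨List.nodup_finRange m, by simp⟩, fun c => ?_, foldlT_bbfStepT_run I.size_le_one two_pos _, ?_⟩
  · refine vlT_isVLPacking hs0 I.size_le_one hε ⟨(List.nodup_finRange n).filter _, fun e => ?_⟩
    simp [hX, ColouredInstance.mem_ofColour]
  · simp only [algorithmT, Timed.bind_val, Timed.pure_val, flatMapT_val, filterT_val, flattenT_val,
      appendT_val, flatten_flatMap]
    rfl

/-! ### Step counts of the list procedures -/

section steps

variable {α β : Type}

@[simp] lemma lengthT_steps (l : List α) : (lengthT l).steps = l.length + 1 := by
  induction l with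
  | nil => rfl
  | cons a l ih =>
    simp [lengthT, ih]
    omega

@[simp] lemma appendT_steps (l l' : List α) : (appendT l l').steps = l.length + 1 := by
  induction l with
  | nil => rfl
  | cons a l ih =>
    simp [appendT, ih]
    omega

@[simp] lemma flattenT_steps (l : List (List α)) :
    (flattenT l).steps = l.flatten.length + 2 * l.length + 1 := by
  induction l with
  | nil => rfl
  | cons a l ih =>
    simp [flattenT, ih]
    omega

lemma filterT_steps_le {p : α → Timed Bool} {l : List α} {c : ℕ} (h : ∀ a ∈ l, (p a).steps ≤ c) :
    (filterT p l).steps ≤ l.length * (c + 1) + 1 := by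
  induction l with
  | nil => simp [filterT]
  | cons a l ih =>
    have h1 := ih fun b hb => h b (by simp [hb])
    have h2 := h a (by simp)
    simp only [filterT, Timed.bind_steps, Timed.tick_steps, Timed.pure_steps, List.length_cons,
      add_one_mul]
    omega

lemma mapT_steps_le {f : α → Timed β} {l : List α} {c : ℕ} (h : ∀ a ∈ l, (f a).steps ≤ c) :
    (mapT f l).steps ≤ l.length * (c + 1) + 1 := by
  induction l with
  | nil => simp [mapT]
  | cons a l ih =>
    have h1 := ih fun b hb => h b (by simp [hb])
    have h2 := h a (by simp)
    simp only [mapT, Timed.bind_steps, Timed.tick_steps, Timed.pure_steps, List.length_cons,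
      add_one_mul]
    omega

lemma flatMapT_steps_le {f : α → Timed (List β)} {l : List α} {c d : ℕ}
    (h : ∀ a ∈ l, (f a).steps ≤ c) (hd : ∀ a ∈ l, (f a).val.length ≤ d) :
    (flatMapT f l).steps ≤ l.length * (c + d + 2) + 1 := by
  induction l with
  | nil => simp [flatMapT]
  | cons a l ih =>
    have h1 := ih (fun b hb => h b (by simp [hb])) (fun b hb => hd b (by simp [hb]))
    have h2 := h a (by simp)
    have h3 := hd a (by simp)
    simp only [flatMapT, Timed.bind_steps, Timed.tick_steps, appendT_steps, List.length_cons,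
      add_one_mul]
    omega

lemma length_flatMap_le {f : α → List β} {l : List α} {d : ℕ} (h : ∀ a ∈ l, (f a).length ≤ d) :
    (l.flatMap f).length ≤ l.length * d := by
  induction l with
  | nil => simp
  | cons a l ih =>
    have h1 := ih fun b hb => h b (by simp [hb])
    have h2 := h a (by simp)
    simp only [List.flatMap_cons, List.length_append, List.length_cons, add_one_mul]
    omega

/-- A fold is cheap if each step increases a measure of the state by at most `d`, and a step is
cheap as long as the measure is at most `M`. -/
lemma foldlT_steps_le {f : β → α → Timed β} (μ : β → ℕ) {d M c : ℕ}
    (hμ : ∀ b a, μ (f b a).val ≤ μ b + d) (hc : ∀ b a, μ b ≤ M → (f b a).steps ≤ c)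
    {l : List α} {b : β} (hb : μ b + d * l.length ≤ M) :
    (foldlT f b l).steps ≤ l.length * (c + 1) + 1 ∧
      μ (foldlT f b l).val ≤ μ b + d * l.length := by
  induction l generalizing b with
  | nil => simp [foldlT]
  | cons a l ih =>
    simp only [List.length_cons, mul_add_one d, add_one_mul l.length] at hb ⊢
    have h1 := hμ b a
    have h2 := hc b a (by omega)
    obtain ⟨h3, h4⟩ := ih (b := (f b a).val) (by omega)
    simp only [foldlT, Timed.bind_steps, Timed.bind_val, Timed.tick_steps]
    omega

lemma splitT_steps_le (q : ℕ) (l : List α) : (splitT q l).steps ≤ l.length + 1 := by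
  induction q generalizing l with
  | zero => simp [splitT]
  | succ q ih =>
    cases l with
    | nil => simp [splitT]
    | cons a l =>
      have := ih l
      simp only [splitT, Timed.bind_steps, Timed.tick_steps, Timed.pure_steps, List.length_cons]
      omega

lemma downT_steps (b : ℕ) : (downT b).steps = b + 1 := by
  induction b with
  | zero => rfl
  | succ b ih =>
    simp only [downT, Timed.bind_steps, Timed.tick_steps, Timed.pure_steps, ih]
    omega

lemma downT_length (b : ℕ) : (downT b).val.length = b + 1 := by
  induction b with
  | zero => rfl
  | succ b ih => simp only [downT, Timed.bind_val, Timed.pure_val, List.length_cons, ih]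

lemma vectorsT_length_le (t b : ℕ) : (vectorsT t b).val.length ≤ (b + 1) ^ t := by
  induction t generalizing b with
  | zero => simp [vectorsT]
  | succ t ih =>
    simp only [vectorsT, Timed.bind_val, Timed.pure_val, flatMapT_val, mapT_val]
    refine (length_flatMap_le (d := (b + 1) ^ t) fun a _ => ?_).trans_eq ?_
    · rw [List.length_map]
      exact (ih _).trans (by gcongr; omega)
    · rw [downT_length, pow_succ']

lemma vectorsT_steps_le (t b : ℕ) : (vectorsT t b).steps ≤ (9 * t + 1) * (b + 1) ^ t := by
  induction t generalizing b with
  | zero => simp [vectorsT]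
  | succ t ih =>
    simp only [vectorsT, Timed.bind_steps, Timed.tick_steps, downT_steps]
    have h1 : ∀ a, (vectorsT t (b - a)).val.length ≤ (b + 1) ^ t := fun a =>
      (vectorsT_length_le t _).trans (by gcongr; omega)
    have h2 : ∀ a, (vectorsT t (b - a)).steps ≤ (9 * t + 1) * (b + 1) ^ t := fun a =>
      (ih _).trans (by gcongr; omega)
    have h3 := flatMapT_steps_le (l := (downT b).val) (c := (9 * t + 1) * (b + 1) ^ t +
        ((b + 1) ^ t * 2 + 1)) (d := (b + 1) ^ t)
      (f := fun a => do
        let vs ← vectorsT t (b - a)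
        mapT (fun v => do tick; pure (a :: v)) vs)
      (fun a _ => by
        simp only [Timed.bind_steps]
        have h4 := mapT_steps_le (f := fun v => do tick; pure (a :: v))
          (l := (vectorsT t (b - a)).val) (c := 1) (fun v _ => by simp)
        exact Nat.add_le_add (h2 a) (h4.trans (by have := h1 a; omega)))
      (fun a _ => by simpa using h1 a)
    rw [downT_length] at h3
    have h4 : 1 ≤ (b + 1) ^ t := Nat.one_le_pow _ _ (by omega)
    have h5 : b + 1 ≤ (b + 1) * (b + 1) ^ t := Nat.le_mul_of_pos_right _ h4
    calc _ ≤ 1 + (b + 1 + ((b + 1) * ((9 * t + 1) * (b + 1) ^ t + ((b + 1) ^ t * 2 + 1)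
            + (b + 1) ^ t + 2) + 1)) := by gcongr
      _ = (9 * t + 4) * ((b + 1) * (b + 1) ^ t) + 4 * (b + 1) + 2 := by ring
      _ ≤ (9 * t + 4) * ((b + 1) * (b + 1) ^ t) + 6 * ((b + 1) * (b + 1) ^ t) := by omega
      _ = (9 * (t + 1) + 1) * (b + 1) ^ (t + 1) := by ring

lemma sumT_steps (v : List ℕ) : (sumT v).steps = v.length + 1 := by
  induction v with
  | nil => rfl
  | cons a v ih =>
    simp only [sumT, Timed.bind_steps, Timed.tick_steps, Timed.pure_steps, ih, List.length_cons]
    omega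

lemma dotT_steps_le (v : List ℕ) (w : List ℝ) : (dotT v w).steps ≤ v.length + 1 := by
  induction v generalizing w with
  | nil => simp [dotT]
  | cons a v ih =>
    cases w with
    | nil => simp [dotT]
    | cons x w =>
      have := ih w
      simp only [dotT, Timed.bind_steps, Timed.tick_steps, Timed.pure_steps, List.length_cons]
      omega

lemma addMulT_steps_le (a : ℕ) (v w : List ℕ) : (addMulT a v w).steps ≤ w.length + 1 := by
  induction v generalizing w with
  | nil => simp [addMulT]
  | cons x v ih =>
    cases w with
    | nil => simp [addMulT]
    | cons y w =>
      have := ih w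
      simp only [addMulT, Timed.bind_steps, Timed.tick_steps, Timed.pure_steps, List.length_cons]
      omega

lemma combineT_steps_le (z as : List ℕ) (τs : List (List ℕ)) :
    (combineT z as τs).steps ≤ as.length * (z.length + 2) + 1 ∧
      (combineT z as τs).val.length ≤ z.length := by
  induction as generalizing τs with
  | nil => simp [combineT]
  | cons a as ih =>
    cases τs with
    | nil => simp [combineT]
    | cons τ τs =>
      obtain ⟨h1, h2⟩ := ih τs
      have h3 := addMulT_steps_le a τ (combineT z as τs).val
      simp only [combineT, Timed.bind_steps, Timed.bind_val, Timed.tick_steps, addMulT_val,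
        List.length_zipWith, List.length_cons, add_one_mul]
      omega

lemma eqT_steps_le (v w : List ℕ) : (eqT v w).steps ≤ v.length + 1 := by
  induction v generalizing w with
  | nil => cases w <;> simp [eqT]
  | cons x v ih =>
    cases w with
    | nil => simp [eqT]
    | cons y w =>
      have := ih w
      simp only [eqT, Timed.bind_steps, Timed.tick_steps, Timed.pure_steps, List.length_cons]
      omega

lemma minSumT_steps_le {t : ℕ} {vs : List (List ℕ)} (h : ∀ v ∈ vs, v.length = t) :
    (minSumT vs).steps ≤ vs.length * (2 * t + 3) + 1 := by
  induction vs with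
  | nil => simp [minSumT]
  | cons v vs ih =>
    have h1 := ih fun w hw => h w (by simp [hw])
    have h2 := h v (by simp)
    simp only [List.length_cons, add_one_mul]
    rcases minSumT_spec vs with ⟨h3, -⟩ | ⟨w, hw, h3, -⟩
    · simp only [minSumT, Timed.bind_steps, Timed.tick_steps, h3, Timed.pure_steps]
      omega
    · have h4 := h w (by simp [hw])
      simp only [minSumT, Timed.bind_steps, Timed.tick_steps, h3, Timed.pure_steps, sumT_steps]
      omega

@[simp] lemma loadT_steps (s : ι → ℝ) (B : List ι) : (loadT s B).steps = B.length + 1 := by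
  induction B with
  | nil => rfl
  | cons e B ih =>
    simp only [loadT, Timed.bind_steps, Timed.tick_steps, Timed.pure_steps, ih, List.length_cons]
    omega

lemma insertT_steps_le (s : ι → ℝ) (e : ι) (l : List ι) :
    (insertT s e l).steps ≤ l.length + 1 := by
  induction l with
  | nil => simp [insertT]
  | cons f l ih =>
    simp only [insertT, Timed.bind_steps, Timed.tick_steps, List.length_cons]
    split_ifs <;> simp only [Timed.bind_steps, Timed.pure_steps] <;> omega

lemma sortT_steps_le (s : ι → ℝ) (l : List ι) :
    (sortT s l).steps ≤ l.length * (l.length + 1) + 1 := by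
  induction l with
  | nil => simp [sortT]
  | cons e l ih =>
    have h1 := insertT_steps_le s e (sortT s l).val
    rw [(sortT_perm s l).length_eq] at h1
    simp only [sortT, Timed.bind_steps, Timed.tick_steps, List.length_cons]
    nlinarith

lemma groupsT_steps_le (q K : ℕ) (L : List ι) :
    (groupsT q K L).steps ≤ K * (L.length + 2) + 1 := by
  induction K generalizing L with
  | zero => simp [groupsT]
  | succ K ih =>
    have h1 := ih (L.drop q)
    have h2 := splitT_steps_le q L
    have h3 : K * ((L.drop q).length + 2) ≤ K * (L.length + 2) := by
      gcongr
      simp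
    simp only [groupsT, Timed.bind_steps, Timed.tick_steps, Timed.pure_steps, splitT_val,
      add_one_mul]
    omega

lemma maxSizeT_steps (s : ι → ℝ) (g : List ι) : (maxSizeT s g).steps = g.length + 1 := by
  induction g with
  | nil => rfl
  | cons e g ih =>
    simp only [maxSizeT, Timed.bind_steps, Timed.tick_steps, Timed.pure_steps, ih, List.length_cons]
    omega

lemma fillBinT_steps_le (τ : List ℕ) (gs : List (List ι)) :
    (fillBinT τ gs).steps ≤ 3 * τ.length + 2 * gs.flatten.length + 1 := by
  induction τ generalizing gs with
  | nil => simp [fillBinT]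
  | cons a τ ih =>
    cases gs with
    | nil => simp [fillBinT]
    | cons g gs =>
      have h1 := ih gs
      have h2 := splitT_steps_le a g
      have h3 : (g.take a).length ≤ g.length := by simp
      simp only [fillBinT, Timed.bind_steps, Timed.tick_steps, Timed.pure_steps, splitT_val,
        appendT_steps, List.length_cons, List.flatten_cons, List.length_append]
      omega

lemma fillCopiesT_steps_le {τ : List ℕ} {K F : ℕ} (hτ : τ.length ≤ K) (a : ℕ)
    {gs : List (List ι)} (hgs : gs.flatten.length ≤ F) :
    (fillCopiesT τ a gs).steps ≤ a * (3 * K + 2 * F + 2) + 1 ∧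
      (fillCopiesT τ a gs).val.1.length = a ∧
      (fillCopiesT τ a gs).val.2.flatten.length ≤ F := by
  induction a generalizing gs with
  | zero => simpa [fillCopiesT] using hgs
  | succ a ih =>
    have h1 := fillBinT_steps_le τ gs
    have h2 := (fillBinT_perm τ gs).length_eq
    rw [List.length_append] at h2
    obtain ⟨h3, h4, h5⟩ := ih (gs := (fillBinT τ gs).val.2) (by omega)
    simp only [fillCopiesT, Timed.bind_steps, Timed.bind_val, Timed.tick_steps, Timed.pure_steps,
      Timed.pure_val, List.length_cons, add_one_mul]
    exact ⟨by omega, by omega, h5⟩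

lemma fillT_steps_le {K F : ℕ} {τs : List (List ℕ)} (hτ : ∀ τ ∈ τs, τ.length ≤ K) (as : List ℕ)
    {gs : List (List ι)} (hgs : gs.flatten.length ≤ F) :
    (fillT as τs gs).steps ≤ as.length * 3 + as.sum * (3 * K + 2 * F + 3) + 1 := by
  induction as generalizing τs gs with
  | nil => simp [fillT]
  | cons a as ih =>
    cases τs with
    | nil =>
      simp only [fillT, Timed.bind_steps, Timed.tick_steps, Timed.pure_steps]
      omega
    | cons τ τs =>
      obtain ⟨h1, h2, h3⟩ := fillCopiesT_steps_le (hτ τ (by simp)) a hgs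
      have h4 := ih (τs := τs) (fun σ hσ => hτ σ (by simp [hσ])) h3
      simp only [fillT, Timed.bind_steps, Timed.tick_steps, appendT_steps, h2, List.length_cons,
        List.sum_cons, add_mul, mul_add] at h1 h4 ⊢
      omega

lemma firstFitItemT_steps_le (s : ι → ℝ) (e : ι) (P : List (List ι)) :
    (firstFitItemT s e P).steps ≤ 2 * (P.flatten.length + P.length) + 3 := by
  induction P with
  | nil => simp [firstFitItemT]
  | cons B P ih =>
    simp only [firstFitItemT, Timed.bind_steps, Timed.tick_steps, loadT_steps, List.length_cons,
      List.flatten_cons, List.length_append]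
    split_ifs <;> simp only [Timed.bind_steps, Timed.pure_steps, appendT_steps] <;> omega

lemma fullestT_steps_le (s : ι → ℝ) (cap : ℝ) {F : ℕ} {l : List (List ι)}
    (h : ∀ B ∈ l, B.length ≤ F) : (fullestT s cap l).steps ≤ l.length * (2 * F + 3) + 1 := by
  induction l with
  | nil => simp [fullestT]
  | cons B l ih =>
    have h1 := ih fun C hC => h C (by simp [hC])
    have h2 := h B (by simp)
    simp only [List.length_cons, add_one_mul]
    rcases fullestT_spec s cap l with ⟨h3, -⟩ | ⟨C, rest, h3, hp, -⟩
    · simp only [fullestT, Timed.bind_steps, Timed.tick_steps, h3, Timed.pure_steps, loadT_steps]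
      omega
    · have h4 := h C (by simp [hp.mem_iff])
      simp only [fullestT, Timed.bind_steps, Timed.tick_steps, h3, Timed.pure_steps, loadT_steps]
      omega

/-- The number of closed bins plus the size of the open ones, empty bins included: a step of Bounded
Best-Fit increases it by at most `2`, and its cost is bounded in terms of it. -/
def BBFState.extent (σ : BBFState ι) : ℕ :=
  σ.closed.length + σ.opened.flatten.length + σ.opened.length

lemma bbfStepT_extent_le (s : ι → ℝ) (k : ℕ) (σ : BBFState ι) (e : ι) :
    (bbfStepT s k σ e).val.extent ≤ σ.extent + 2 := by
  obtain ⟨cl, op⟩ := σ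
  rcases fullestT_spec s (1 - s e) op with ⟨h, -⟩ | ⟨B, rest, h, hp, -⟩
  · by_cases hlt : op.length < k
    · simp [bbfStepT, h, hlt, BBFState.extent]
      omega
    · rcases fullestT_spec s 1 op with ⟨h', -⟩ | ⟨B, rest, h', hp, -⟩
      · simp [bbfStepT, h, hlt, h', BBFState.extent]
        omega
      · have h1 := hp.length_eq
        have h2 := hp.flatten.length_eq
        simp only [List.length_cons, List.flatten_cons, List.length_append] at h1 h2
        simp [bbfStepT, h, hlt, h', BBFState.extent]
        simp at h2
        omega
  · have h1 := hp.length_eq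
    have h2 := hp.flatten.length_eq
    simp only [List.length_cons, List.flatten_cons, List.length_append] at h1 h2
    simp [bbfStepT, h, BBFState.extent]
    simp at h2
    omega

lemma length_le_length_flatten {l : List (List α)} {B : List α} (hB : B ∈ l) :
    B.length ≤ l.flatten.length :=
  (List.sublist_flatten_of_mem hB).length_le

lemma bbfStepT_steps_le (s : ι → ℝ) (k : ℕ) {σ : BBFState ι} (e : ι) {M : ℕ} (hM : σ.extent ≤ M) :
    (bbfStepT s k σ e).steps ≤ 2 * (M * (2 * M + 3)) + M + 4 := by
  obtain ⟨cl, op⟩ := σ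
  simp only [BBFState.extent] at hM
  have hF : ∀ B ∈ op, B.length ≤ M := fun B hB => by
    have := length_le_length_flatten hB
    omega
  have hop : op.length * (2 * M + 3) ≤ M * (2 * M + 3) := by
    gcongr
    omega
  have h1 := fullestT_steps_le s (1 - s e) hF
  have h2 := fullestT_steps_le s 1 hF
  rcases fullestT_spec s (1 - s e) op with ⟨h, -⟩ | ⟨B, rest, h, hp, -⟩
  · by_cases hlt : op.length < k
    · simp only [bbfStepT, Timed.bind_steps, Timed.tick_steps, h, lengthT_steps, lengthT_val, hlt,
        if_true, Timed.pure_steps]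
      omega
    · rcases fullestT_spec s 1 op with ⟨h', -⟩ | ⟨B, rest, h', hp, -⟩ <;>
      · simp only [bbfStepT, Timed.bind_steps, Timed.tick_steps, h, lengthT_steps, lengthT_val, hlt,
          if_false, h', Timed.pure_steps]
        omega
  · have h3 := hF B (by simp [hp.mem_iff])
    simp only [bbfStepT, Timed.bind_steps, Timed.tick_steps, h, appendT_steps, Timed.pure_steps]
    omega

end steps

/-! ### The algorithm runs in polynomial time -/

/-- A bound for the number of steps of `packLargeT` on `x` items, where `K` is the number of groups,
`V` bounds the cost of enumerating the candidate types and `T` their number. The summands bound the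
calls in the body of `packLargeT`, in order. It is stated over any semiring, so that it can be
evaluated at numbers and at polynomials. -/
def packLargeBound {R : Type} [CommSemiring R] (K V T : ℕ) (x : R) : R :=
  1 + (x + 1) + (K * (x + 2) + 1) + (K * (x + 2) + 1) + (K * (x + 2) + 1) + (K * 2 + 1) + V
    + (T * (K + 2) + 1) + (T + 1) + (9 * T + 1) * (x + 1) ^ T
    + ((x + 1) ^ T * (T * (K + 2) + K + 3) + 1) + ((x + 1) ^ T * (2 * T + 3) + 1)
    + (T * 3 + x * (3 * K + 2 * x + 3) + 1)

lemma length_le_of_mem_groups {q K : ℕ} {L g : List ι} (hg : g ∈ groups q K L) :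
    g.length ≤ L.length := by
  refine (length_le_length_flatten hg).trans ?_
  rw [groups_flatten]
  simp

lemma packLargeT_steps_le (s : ι → ℝ) (ε : ℝ) (L : List ι) :
    (packLargeT s ε L).steps ≤ packLargeBound ⌈1 / ε ^ 2⌉₊
      ((9 * ⌈1 / ε ^ 2⌉₊ + 1) * (⌊1 / ε⌋₊ + 1) ^ ⌈1 / ε ^ 2⌉₊)
      ((⌊1 / ε⌋₊ + 1) ^ ⌈1 / ε ^ 2⌉₊) L.length := by
  set K := ⌈1 / ε ^ 2⌉₊ with hK
  set b := ⌊1 / ε⌋₊ with hb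
  set N := L.length with hN
  set q := ⌈(N : ℝ) * ε ^ 2⌉₊ with hq
  set T := (b + 1) ^ K with hT
  set gs := groups q K L with hgs
  have hgsK : gs.length = K := length_groups _ _ _
  have hgN : ∀ g ∈ gs, g.length ≤ N := fun g hg => length_le_of_mem_groups hg
  set sizes := gs.map fun g => (maxSizeT s g).val with hsizes
  set types := (vectorsT K b).val.filter fun τ => decide ((dotT τ sizes).val ≤ 1) with htypes
  set packings := (vectorsT types.length N).val.filter
    fun v => decide ((combineT (gs.map fun _ => 0) v types).val = gs.map List.length) with hpackings
  set best := (minSumT packings).val.getD [] with hbest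
  have hsteps : (packLargeT s ε L).steps = 1 + ((lengthT L).steps + ((groupsT q K L).steps
      + ((mapT (maxSizeT s) gs).steps + ((mapT lengthT gs).steps
      + ((mapT (fun _ => do tick; pure 0 : List ι → Timed ℕ) gs).steps + ((vectorsT K b).steps
      + ((filterT (fun τ => do let w ← dotT τ sizes; pure (decide (w ≤ 1)))
        (vectorsT K b).val).steps
      + ((lengthT types).steps + ((vectorsT types.length N).steps
      + ((filterT (fun v => do
          let d ← combineT (gs.map fun _ => 0) v types
          eqT d (gs.map List.length)) (vectorsT types.length N).val).steps
      + ((minSumT packings).steps + (fillT best types gs).steps))))))))))) := by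
    simp only [packLargeT, Timed.bind_steps, Timed.bind_val, Timed.pure_val, Timed.tick_steps,
      lengthT_val, groupsT_val, mapT_val, filterT_val, eqT_val]
    rfl
  have htK : ∀ τ ∈ types, τ.length = K := fun τ hτ =>
    (mem_vectorsT.1 (List.mem_of_mem_filter hτ)).1
  have hVT : (vectorsT K b).val.length ≤ T := vectorsT_length_le _ _
  have htT : types.length ≤ T := (List.length_filter_le _ _).trans hVT
  have hM : (vectorsT types.length N).val.length ≤ (N + 1) ^ T :=
    (vectorsT_length_le _ _).trans (Nat.pow_le_pow_right (by omega) htT)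
  have hpM : packings.length ≤ (N + 1) ^ T := (List.length_filter_le _ _).trans hM
  have hp : ∀ v ∈ packings, v.length = types.length ∧ v.sum ≤ N := fun v hv =>
    mem_vectorsT.1 (List.mem_of_mem_filter hv)
  have hbestN : best.length ≤ T ∧ best.sum ≤ N := by
    rcases minSumT_spec packings with ⟨h, -⟩ | ⟨w, hw, h, -⟩
    · simp [hbest, h]
    · rw [hbest, h, Option.getD_some, (hp w hw).1]
      exact ⟨htT, (hp w hw).2⟩
  have h1 : _ ≤ K * (N + 2) + 1 := groupsT_steps_le q K L
  have h2 : _ ≤ gs.length * (N + 2) + 1 := mapT_steps_le (f := maxSizeT s) (c := N + 1)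
    fun g hg => by
      rw [maxSizeT_steps]
      exact Nat.add_le_add_right (hgN g hg) 1
  have h3 : _ ≤ gs.length * (N + 2) + 1 := mapT_steps_le (f := lengthT) (c := N + 1)
    fun g hg => by
      rw [lengthT_steps]
      exact Nat.add_le_add_right (hgN g hg) 1
  have h4 := mapT_steps_le (f := (fun _ => do tick; pure 0 : List ι → Timed ℕ)) (l := gs) (c := 1)
    fun g hg => by simp
  have h5 : (vectorsT K b).steps ≤ (9 * K + 1) * T := vectorsT_steps_le K b
  have h6 : _ ≤ T * (K + 2) + 1 := (filterT_steps_le (l := (vectorsT K b).val) (c := K + 1)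
    (p := fun τ => do let w ← dotT τ sizes; pure (decide (w ≤ 1))) fun τ hτ => by
      have := dotT_steps_le τ sizes
      rw [(mem_vectorsT.1 hτ).1] at this
      simpa using this).trans (by gcongr)
  have h7 : (vectorsT types.length N).steps ≤ (9 * T + 1) * (N + 1) ^ T :=
    (vectorsT_steps_le _ _).trans (by gcongr; omega)
  have h8 : _ ≤ (N + 1) ^ T * (T * (K + 2) + K + 3) + 1 :=
    (filterT_steps_le (l := (vectorsT types.length N).val) (c := T * (K + 2) + K + 2)
    (p := fun v => do
      let d ← combineT (gs.map fun _ => 0) v types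
      eqT d (gs.map List.length)) fun v hv => by
      obtain ⟨i1, i2⟩ := combineT_steps_le (gs.map fun _ => 0) v types
      have i3 := eqT_steps_le (combineT (gs.map fun _ => 0) v types).val (gs.map List.length)
      rw [List.length_map, hgsK] at i1 i2
      rw [(mem_vectorsT.1 hv).1] at i1
      have i4 : types.length * (K + 2) ≤ T * (K + 2) := by gcongr
      rw [Timed.bind_steps]
      omega).trans (by gcongr)
  have h9 : (minSumT packings).steps ≤ (N + 1) ^ T * (2 * T + 3) + 1 :=
    (minSumT_steps_le fun v hv => (hp v hv).1).trans (by gcongr)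
  have h10 : (fillT best types gs).steps ≤ T * 3 + N * (3 * K + 2 * N + 3) + 1 := by
    refine (fillT_steps_le (K := K) (F := N) (fun τ hτ => (htK τ hτ).le) best ?_).trans ?_
    · rw [hgs, groups_flatten]
      simp [hN]
    · obtain ⟨i1, i2⟩ := hbestN
      gcongr
  rw [hgsK] at h2 h3 h4
  rw [hsteps, lengthT_steps, lengthT_steps]
  simp only [packLargeBound, Nat.cast_id]
  omega

/-- A bound for the number of steps of `vlT` on `x` items. -/
def vlBound {R : Type} [CommSemiring R] (K V T : ℕ) (x : R) : R :=
  1 + (x * 2 + 1) + (x * 2 + 1) + (x * (x + 1) + 1) + packLargeBound K V T x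
    + (x * (2 * (4 * x) + 4) + 1)

lemma packLargeBound_mono (K V T : ℕ) {x y : ℕ} (h : x ≤ y) :
    packLargeBound K V T x ≤ packLargeBound K V T y := by
  unfold packLargeBound
  gcongr

lemma vlBound_mono (K V T : ℕ) {x y : ℕ} (h : x ≤ y) : vlBound K V T x ≤ vlBound K V T y := by
  unfold vlBound
  gcongr
  exact packLargeBound_mono K V T h

lemma vlT_steps_le {s : ι → ℝ} (hs0 : ∀ e, 0 ≤ s e) (hs1 : ∀ e, s e ≤ 1) {ε : ℝ} (hε : 0 < ε)
    {X : List ι} (hX : X.Nodup) :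
    (vlT s ε X).steps ≤ vlBound ⌈1 / ε ^ 2⌉₊
      ((9 * ⌈1 / ε ^ 2⌉₊ + 1) * (⌊1 / ε⌋₊ + 1) ^ ⌈1 / ε ^ 2⌉₊)
      ((⌊1 / ε⌋₊ + 1) ^ ⌈1 / ε ^ 2⌉₊) X.length ∧
    (vlT s ε X).val.length ≤ 4 * X.length := by
  set large := X.filter fun e => decide (ε ≤ s e) with hlarge
  set small := X.filter fun e => decide (s e < ε) with hsmall
  set L := (sortT s large).val with hL
  have hLp : L.Perm large := sortT_perm s large
  have hlX : large.length ≤ X.length := List.length_filter_le _ _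
  have hsX : small.length ≤ X.length := List.length_filter_le _ _
  have hsteps : (vlT s ε X).steps =
      1 + ((filterT (fun e => do tick; pure (decide (ε ≤ s e))) X).steps
      + ((filterT (fun e => do tick; pure (decide (s e < ε))) X).steps
      + ((sortT s large).steps + ((packLargeT s ε L).steps
      + (foldlT (fun P e => firstFitItemT s e P) (packLargeT s ε L).val small).steps)))) := by
    simp only [vlT, Timed.bind_steps, Timed.bind_val, Timed.pure_val, Timed.tick_steps,
      filterT_val]
    rfl
  have hval : (vlT s ε X).val =
      (foldlT (fun P e => firstFitItemT s e P) (packLargeT s ε L).val small).val := by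
    simp only [vlT, Timed.bind_val, Timed.pure_val, filterT_val]
    rfl
  have hLε : ∀ e ∈ L, ε ≤ s e := fun e he => by
    simpa using (List.mem_filter.1 (hLp.mem_iff.1 he)).2
  obtain ⟨r, hr, hQ, -, hmin⟩ := packLargeT_spec hε hs0 hs1 (hLp.nodup_iff.2 (hX.filter _)) hLε
  have hQL : (packLargeT s ε L).val.length ≤ L.length := by
    refine (hmin (L.map fun e => [e]) (by rw [flatten_map_singleton]) ?_).trans_eq
      (List.length_map _)
    simpa using fun e he => (rounded_bounds hs1 hε hr he).2
  have hLl := hLp.length_eq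
  have h1 := filterT_steps_le (l := X) (c := 1)
    (p := fun e => do tick; pure (decide (ε ≤ s e))) (fun _ _ => by simp)
  have h2 := filterT_steps_le (l := X) (c := 1)
    (p := fun e => do tick; pure (decide (s e < ε))) (fun _ _ => by simp)
  have h3 : (sortT s large).steps ≤ X.length * (X.length + 1) + 1 :=
    (sortT_steps_le s large).trans (by gcongr)
  have h4 := (packLargeT_steps_le s ε L).trans
    (packLargeBound_mono _ _ _ (hLl.le.trans hlX))
  obtain ⟨h5, h6⟩ := foldlT_steps_le (f := fun P e => firstFitItemT s e P)
    (b := (packLargeT s ε L).val) (l := small) (d := 2) (M := 4 * X.length)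
    (c := 2 * (4 * X.length) + 3)
    (fun P => P.flatten.length + P.length)
    (fun P e => by
      have i1 := (firstFitItem_flatten_perm s e P).length_eq
      simp only [List.length_append, List.length_singleton] at i1
      rw [firstFitItemT_val]
      rcases firstFitItem_cases (hs0 e) 0 P with ⟨i2, -⟩ | ⟨i2, -⟩
      · have i3 := congrArg List.length i2
        simp only [List.length_append, List.length_singleton] at i3
        omega
      · omega)
    (fun P e hP => (firstFitItemT_steps_le s e P).trans (by gcongr))
    (by rw [hQ.length_eq]; omega)
  have h7 : small.length * (2 * (4 * X.length) + 3 + 1) ≤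
      X.length * (2 * (4 * X.length) + 4) := by gcongr
  rw [hQ.length_eq] at h6
  rw [hsteps, hval, vlBound]
  omega

/-- A bound for the number of steps of `algorithmT` on an instance for which the numbers of items
and colours add up to `x`. -/
def algorithmBound {R : Type} [CommSemiring R] (K V T : ℕ) (x : R) : R :=
  1 + (x * ((x * 2 + 1) + vlBound K V T x + (x + 2 * (4 * x) + 1) + x + 2) + 1)
    + (x * x * (2 * (2 * (x * x) * (2 * (2 * (x * x)) + 3)) + 2 * (x * x) + 4 + 1) + 1)
    + (2 * (x * x) + 1)

lemma algorithmT_steps_le {ε : ℝ} (hε : 0 < ε) {n m : ℕ} (I : ColouredInstance n m) :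
    (algorithmT ε I).steps ≤ algorithmBound ⌈1 / ε ^ 2⌉₊
      ((9 * ⌈1 / ε ^ 2⌉₊ + 1) * (⌊1 / ε⌋₊ + 1) ^ ⌈1 / ε ^ 2⌉₊)
      ((⌊1 / ε⌋₊ + 1) ^ ⌈1 / ε ^ 2⌉₊) (n + m) := by
  set K := ⌈1 / ε ^ 2⌉₊ with hK
  set T := (⌊1 / ε⌋₊ + 1) ^ K with hT
  set V := (9 * K + 1) * T with hV
  have hs0 : ∀ e, 0 ≤ I.size e := fun e => (I.size_pos e).le
  have hs1 := I.size_le_one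
  set X : Fin m → List (Fin n) := fun c => (List.finRange n).filter fun e =>
    decide (I.colour e = c) with hX
  set pack : Fin m → Timed (List (Fin n)) := fun c => do
    let X ← filterT (fun e => do tick; pure (decide (I.colour e = c))) (List.finRange n)
    let P ← vlT I.size ε X
    flattenT P with hpack
  set order := (List.finRange m).flatMap fun c => (pack c).val with horder
  set x := n + m with hx
  have hsteps : (algorithmT ε I).steps = 1 + ((flatMapT pack (List.finRange m)).steps
      + ((foldlT (bbfStepT I.size 2) ⟨[], []⟩ order).steps
      + ((foldlT (bbfStepT I.size 2) ⟨[], []⟩ order).val.closed.length + 1))) := by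
    simp only [algorithmT, Timed.bind_steps, Timed.tick_steps, flatMapT_val, appendT_steps]
    rfl
  have hXn : ∀ c, (X c).length ≤ n := fun c =>
    (List.length_filter_le _ _).trans_eq (List.length_finRange)
  have hXnd : ∀ c, (X c).Nodup := fun c => (List.nodup_finRange n).filter _
  have hflat : ∀ c, (vlT I.size ε (X c)).val.flatten.length = (X c).length := by
    intro c
    have h1 := vlT_isVLPacking (X := (X c).toFinset) hs0 hs1 hε ⟨hXnd c, by simp⟩
    exact ((h1.isPacking hs1 hε).1.perm ⟨hXnd c, by simp⟩).length_eq
  have hpv : ∀ c, (pack c).val = (vlT I.size ε (X c)).val.flatten := by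
    intro c
    simp only [hpack, Timed.bind_val, Timed.pure_val, filterT_val, flattenT_val]
    rfl
  have hps : ∀ c, (pack c).steps ≤ (x * 2 + 1) + vlBound K V T x + (x + 2 * (4 * x) + 1) := by
    intro c
    have h1 := filterT_steps_le (l := List.finRange n) (c := 1)
      (p := fun e => do tick; pure (decide (I.colour e = c))) (fun _ _ => by simp)
    obtain ⟨h2, h3⟩ := vlT_steps_le hs0 hs1 hε (hXnd c)
    have h4 : (vlT I.size ε (X c)).steps ≤ vlBound K V T x :=
      h2.trans (vlBound_mono K V T ((hXn c).trans (Nat.le_add_right n m)))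
    have h5 := hXn c
    have h6 := hflat c
    have h7 : (pack c).steps = (filterT (fun e => do tick; pure (decide (I.colour e = c)))
        (List.finRange n)).steps + ((vlT I.size ε (X c)).steps
        + ((vlT I.size ε (X c)).val.flatten.length + 2 * (vlT I.size ε (X c)).val.length + 1)) := by
      simp only [hpack, Timed.bind_steps, Timed.bind_val, Timed.pure_val, filterT_val,
        flattenT_steps]
      rfl
    rw [List.length_finRange] at h1
    rw [h7]
    omega
  have hpl : ∀ c, (pack c).val.length ≤ x := fun c => by
    rw [hpv, hflat]
    exact (hXn c).trans (Nat.le_add_right n m)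
  have horderl : order.length ≤ x * x := by
    refine (length_flatMap_le fun c _ => hpl c).trans ?_
    rw [List.length_finRange]
    gcongr
    omega
  have h1 := flatMapT_steps_le (l := List.finRange m) (fun c _ => hps c) (fun c _ => hpl c)
  rw [List.length_finRange] at h1
  have h2 : m * ((x * 2 + 1) + vlBound K V T x + (x + 2 * (4 * x) + 1) + x + 2) ≤
      x * ((x * 2 + 1) + vlBound K V T x + (x + 2 * (4 * x) + 1) + x + 2) := by
    gcongr
    omega
  obtain ⟨h3, h4⟩ := foldlT_steps_le (f := bbfStepT I.size 2) (b := ⟨[], []⟩) (l := order)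
    BBFState.extent (d := 2) (M := 2 * (x * x)) (bbfStepT_extent_le I.size 2)
    (fun σ e hσ => bbfStepT_steps_le I.size 2 e hσ) (by simp [BBFState.extent, horderl])
  have h5 : order.length *
      (2 * (2 * (x * x) * (2 * (2 * (x * x)) + 3)) + 2 * (x * x) + 4 + 1) ≤ x * x *
      (2 * (2 * (x * x) * (2 * (2 * (x * x)) + 3)) + 2 * (x * x) + 4 + 1) := by gcongr
  have h6 : (foldlT (bbfStepT I.size 2) ⟨[], []⟩ order).val.closed.length ≤ 2 * order.length := by
    simp only [BBFState.extent, List.length_nil, List.flatten_nil] at h4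
    omega
  rw [hsteps, algorithmBound]
  omega

lemma eval_algorithmBound (K V T x : ℕ) :
    (algorithmBound K V T (Polynomial.X : Polynomial ℕ)).eval x = algorithmBound K V T x := by
  simp [algorithmBound, vlBound, packLargeBound]

end ColouredBinPacking

end

open ColouredBinPacking in
theorem mainTheorem4 :
    (∃ C : ℝ, ∀ ε : ℝ, 0 < ε → ∀ (n m : ℕ) (I : ColouredInstance n m) (P : List (List (Fin n))),
      IsOutput ε n m I P →
        IsPacking I.size Finset.univ P ∧
        (∀ c : Fin m,
          (span I P c : ℝ) ≤ (1 + 2 * ε) * (OPT I.size (I.ofColour c) : ℝ) + 3) ∧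
        (P.length : ℝ) ≤ 1.7 * (OPT I.size Finset.univ : ℝ) + C) ∧
    (∀ ε : ℝ, 0 < ε → IsApproximationAlgorithm 1.7 (1 + ε) (IsOutput (ε / 2))) ∧
    (∀ ε : ℝ, 0 < ε → ∃ p : Polynomial ℕ, ∀ (n m : ℕ) (I : ColouredInstance n m),
      IsOutput ε n m I (algorithmT ε I).val ∧ (algorithmT ε I).steps ≤ p.eval (n + m)) := by
  refine ⟨⟨2, fun ε hε n m I P h => h.bounds hε⟩, fun ε hε => ⟨3, fun n m I => ?_⟩, fun ε hε => ?_⟩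
  · refine ⟨⟨_, algorithmT_isOutput (half_pos hε) I⟩, fun P h => ?_⟩
    obtain ⟨h1, h2, h3⟩ := h.bounds (half_pos hε)
    refine ⟨h1, by linarith, fun c => ?_⟩
    have h4 := h2 c
    rwa [mul_div_cancel₀ ε two_ne_zero] at h4
  · refine ⟨algorithmBound ⌈1 / ε ^ 2⌉₊
      ((9 * ⌈1 / ε ^ 2⌉₊ + 1) * (⌊1 / ε⌋₊ + 1) ^ ⌈1 / ε ^ 2⌉₊)
      ((⌊1 / ε⌋₊ + 1) ^ ⌈1 / ε ^ 2⌉₊) Polynomial.X, fun n m I => ⟨algorithmT_isOutput hε I, ?_⟩⟩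
    rw [eval_algorithmBound]
    exact algorithmT_steps_le hε I
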